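/- **Theorem 5.1 (Estimation of ATE under Scenario I).** *Setting.* An observational study is a probability distribution $\mathcal D$ of $(X,T,Y(0),Y(1))$ on $\mathbb R^d\times\{0,1\}\times\mathbb R\times\mathbb R$; its censored distribution $\mathcal C_{\mathcal D}$ is the law of $(X,T,Y(T))$, and $\tau_{\mathcal D}=\mathbb E_{\mathcal D}[Y(1)-Y(0)]$. Its generalized propensity scores are $p_t(x,y)=\Pr_{\mathcal D}[T=t\mid X=x,\,Y(t)=y]$, $t\in\{0,1\}$. For a class $\mathbb P$ of functions $\mathbb R^d\times\mathbb R\to[0,1]$ and a class $\mathbb D$ of probability distributions on $\mathbb R^d\times\mathbb R$, $\mathcal D$ is *realizable* with respect to $(\mathbb P,\mathbb D)$ if, for both $t\in\{0,1\}$, (a Borel version of) $p_t$ belongs to $\mathbb P$ and the law of $(X,Y(t))$ belongs to $\mathbb D$. Let $$\mathbb P_{\mathrm{OU}}(c)=\{p:\mathbb R^d\times\mathbb R\to[0,1]\;:\;p(x,y)=p(x,z)\text{ and }c<p(x,y)<1-c\text{ for all }x,y,z\}$$ (unconfoundedness and $c$-overlap). A finite set $S$ is $\gamma$-shattered by $\mathbb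 P$ if there are thresholds $(r_s)_{s\in S}$ such that for every $b\in\{\pm1\}^S$ some $f\in\mathbb P$ satisfies $b_s(f(s)-r_s)\ge\gamma$ for all $s\in S$; $\mathrm{fat}_\gamma(\mathbb P)$ is the supremum of the cardinalities of $\gamma$-shattered sets. As a standing convention, covariates have densities: there is a $\sigma$-finite measure $\nu$ on $\mathbb R^d$ (for instance Lebesgue measure, or counting measure on a countable set) such that the $X$-marginal of every $\mathcal P\in\mathbb D$ is absolutely continuous with respect to $\nu$. *Statement.* There are universal constants $\eta\ge 1/256$ and $C>0$ such that the following holds for all $d$, all $c\in(0,1/2)$, $B>0$, $\varepsilon,\delta\in(0,1)$, and all such $\mathbb P$, $\mathbb D$, $\nu$. Assume 1. $\mathbb P\subseteq\mathbb P_{\mathrm{OU}}(c)$ and $\mathrm{fat}_{\eta c^2\varepsilon/B}(\mathbb P)<\infty$; 2. under every $\mathcal P\in\mathbb D$ the outcome lies in $[-B,B]$ almost surely. Then for every $$n\;\ge\;C\,\frac{B^2}{c^4\varepsilon^2}\Big(\mathrm{fat}_{\eta c^2\varepsilon/B}(\mathbb P)\,\log\frac{B}{c^2\varepsilon}+\log\frac{2}{\delta}\Big)$$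 there are $k\le n$ and a measurable rule that computes from the first $k$ samples a propensity score estimate $\hat e:\mathbb R^d\to(c,1-c)$, such that, for every $\mathcal D$ realizable with respect to $(\mathbb P,\mathbb D)$, given $n$ i.i.d. samples $(x_i,t_i,y_i)$ from $\mathcal C_{\mathcal D}$, the inverse-propensity-weighted estimator $$\hat\tau=\frac1{n-k}\sum_{i=k+1}^{n}\Big(\frac{y_it_i}{\hat e(x_i)}-\frac{y_i(1-t_i)}{1-\hat e(x_i)}\Big)$$ (read as $0$ if $k=n$) satisfies $|\hat\tau-\tau_{\mathcal D}|\le\varepsilon$ with probability at least $1-\delta$. -/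

import Mathlib

open MeasureTheory ProbabilityTheory

noncomputable section

namespace CausalATE

/-- Covariates: points of `ℝ^d`. -/
abbrev Cov (d : ℕ) : Type := EuclideanSpace ℝ (Fin d)

/-- A full record `(x, t, y₀, y₁)`: covariates, treatment indicator (`true` is `T = 1`), and the
two potential outcomes `Y(0)`, `Y(1)`. -/
abbrev Record (d : ℕ) : Type := Cov d × Bool × ℝ × ℝ

/-- A censored sample `(x, t, y)`, where `y` is the outcome `Y(t)` of the arm received. -/
abbrev Sample (d : ℕ) : Type := Cov d × Bool × ℝ

/-- The potential outcome `Y(t)`. -/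
def potentialOutcome {d : ℕ} (t : Bool) (u : Record d) : ℝ := if t then u.2.2.2 else u.2.2.1

/-- The pair `(X, Y(t))`. -/
def covOutcome {d : ℕ} (t : Bool) (u : Record d) : Cov d × ℝ := (u.1, potentialOutcome t u)

/-- The censored record `(X, T, Y(T))`. -/
def censor {d : ℕ} (u : Record d) : Sample d := (u.1, u.2.1, potentialOutcome u.2.1 u)

/-- The censored distribution of an observational study. -/
def censoredLaw {d : ℕ} (D : Measure (Record d)) : Measure (Sample d) := D.map censor

/-- The average treatment effect `E[Y(1) - Y(0)]`. -/
def ate {d : ℕ} (D : Measure (Record d)) : ℝ :=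
  ∫ u, (potentialOutcome true u - potentialOutcome false u) ∂D

/-- `p` is (a Borel version of) the generalized propensity score
`p_t(x, y) = Pr[T = t | X = x, Y(t) = y]`. -/
def IsGenPropensity {d : ℕ} (D : Measure (Record d)) (t : Bool) (p : Cov d × ℝ → ℝ) : Prop :=
  Measurable p ∧
    (fun u => p (covOutcome t u)) =ᵐ[D]
      D⟦{u : Record d | u.2.1 = t} | MeasurableSpace.comap (covOutcome t) inferInstance⟧

/-- `D` is realizable with respect to `(P, Q)`: both generalized propensity scores lie in `P`, and
the laws of `(X, Y(0))` and `(X, Y(1))` lie in `Q`. -/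
def Realizable {d : ℕ} (P : Set (Cov d × ℝ → ℝ)) (Q : Set (ProbabilityMeasure (Cov d × ℝ)))
    (D : Measure (Record d)) : Prop :=
  ∀ t : Bool, (∃ p ∈ P, IsGenPropensity D t p) ∧
    ∃ q ∈ Q, (q : Measure (Cov d × ℝ)) = D.map (covOutcome t)

/-- The class of generalized propensity scores expressing unconfoundedness and `c`-overlap. -/
def overlapUnconf (d : ℕ) (c : ℝ) : Set (Cov d × ℝ → ℝ) :=
  {p | (∀ w, p w ∈ Set.Icc (0 : ℝ) 1) ∧
    ∀ (x : Cov d) (y z : ℝ), p (x, y) = p (x, z) ∧ c < p (x, y) ∧ p (x, y) < 1 - c}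

/-- `S` is `γ`-shattered by `F`, with thresholds `r`. -/
def FatShatters {α : Type*} (F : Set (α → ℝ)) (γ : ℝ) (S : Finset α) : Prop :=
  ∃ r : α → ℝ, ∀ b : α → ℝ, (∀ s ∈ S, b s = 1 ∨ b s = -1) →
    ∃ f ∈ F, ∀ s ∈ S, γ ≤ b s * (f s - r s)

/-- The fat-shattering dimension of `F` at scale `γ`. -/
def fatDim {α : Type*} (F : Set (α → ℝ)) (γ : ℝ) : ℕ∞ :=
  ⨆ (S : Finset α) (_ : FatShatters F γ S), (S.card : ℕ∞)

/-- One summand `y t / e(x) - y (1 - t) / (1 - e(x))` of the inverse-propensity-weighted sum. -/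
def ipwTerm {d : ℕ} (e : Cov d → ℝ) (s : Sample d) : ℝ :=
  s.2.2 * (if s.2.1 then 1 else 0) / e s.1 - s.2.2 * (1 - if s.2.1 then 1 else 0) / (1 - e s.1)

/-- The inverse-propensity-weighted estimator with a learned propensity score: `learn` produces the
estimated propensity score from the first `k` of the `n` samples, and the weighted outcomes are
averaged over the remaining `n - k` samples. -/
def ipwEstimator {d n k : ℕ} (hk : k ≤ n) (learn : (Fin k → Sample d) → Cov d → ℝ)
    (S : Fin n → Sample d) : ℝ :=
  (1 / ((n : ℝ) - (k : ℝ))) *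
    ∑ i : Fin n with k ≤ i.val, ipwTerm (learn fun j => S (Fin.castLE hk j)) (S i)

end CausalATE

end

/-!
Write `γ = c²ε/(256B)` for the scale at which the fat-shattering dimension `D` is finite. Inverse
propensity weighting with an estimate `ê` of the propensity score `e` has bias at most
`(2B/c) E|ê(X) - e(X)|` (`abs_integral_ipwTerm_sub_ate_le`), so it suffices to learn `e` in `L¹` to
accuracy `212γ`; Hoeffding's inequality on the samples not used for learning does the rest
(`measure_ipwEstimator_failure_le`).

The learner (`exists_learner`) uses two blocks of `m` samples. The first block gives a finite
empirical `L¹` cover of the class. By symmetrization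
(`measure_exists_mean_le_lt_integral_le`), closeness on the sample implies closeness in `L¹` of the
unknown law, so some member of the cover is close to `e`. The second block selects a member of the
cover: the residual of each candidate is tested against the signs of its differences with all other
candidates, and any candidate passing the tests is close to `e` (`integral_abs_sub_le_of_tests`).
These tests are linear in the treatment indicator, so Hoeffding's inequality already yields the rate
`m ~ γ⁻² log N`, where `N` is the size of the cover.

A single logarithm in the sample size requires `log N` to be of order `D log (1/γ)`, up to a small
multiple of `mγ²`. In the manner of Mendelson and Vershynin, a family of functions which is
separated in empirical `L¹` distance can be split at a level of one coordinate into two large parts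
with a margin between them (`exists_isLargeSplit`); iterating, a family of size `N` shatters at least
`√N` patterns of points and grid levels (`sqrt_card_le_card_gridShattered`). All these patterns are
supported on at most `D` points, and the generating function of such patterns bounds their number
(`card_le_of_support_le`). Evaluating it at a point of order `γ³` gives `coverBound_le`, with no
subsampling of coordinates.

Measurability of the rule is arranged by replacing the class with a sequence that is dense in `L¹`
of every law dominated by the reference measure (`exists_seq_dense`). When `2B ≤ ε` the effect itself
is at most `ε`, and the empty average is accurate.
-/

open MeasureTheory ProbabilityTheory

namespace CausalATE

/-! ### Splitting a finite family at a grid threshold -/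

section Combinatorics

variable {κ ι : Type*}

/-- The grid level `jγ` splits the values `(a k)_{k ∈ J}` with margin `γ` on both sides, into two
nonempty parts that are large in the sense that the square roots of their sizes add up to at least
`√|J|`. -/
def IsLargeSplit (J : Finset κ) (a : κ → ℝ) (γ : ℝ) (j : ℤ) : Prop :=
  (J.filter fun k => (j + 1) * γ ≤ a k).Nonempty ∧ (J.filter fun k => a k ≤ (j - 1) * γ).Nonempty ∧
    √(J.card : ℝ) ≤ √((J.filter fun k => (j + 1) * γ ≤ a k).card : ℝ)
      + √((J.filter fun k => a k ≤ (j - 1) * γ).card : ℝ)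

/-- Without a large split, the upper tails of the values decay doubly exponentially along the
grid. -/
lemma card_upper_le_sq {J : Finset κ} {a : κ → ℝ} {γ q : ℝ} (hJ : J.Nonempty)
    (hno : ∀ j : ℤ, ¬ IsLargeSplit J a γ j) (j : ℤ) (hq0 : 0 ≤ q) (hq : q ≤ 1 / 2)
    (hU : ((J.filter fun k => j * γ < a k).card : ℝ) ≤ q * J.card) :
    ((J.filter fun k => (j + 2) * γ ≤ a k).card : ℝ) ≤ q ^ 2 * J.card := by
  have hN : (0 : ℝ) < J.card := by exact_mod_cast hJ.card_pos
  have hsum : ((J.filter fun k => j * γ < a k).card : ℝ)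
      + ((J.filter fun k => a k ≤ j * γ).card : ℝ) = J.card := by
    have h := Finset.card_filter_add_card_filter_not (s := J) (fun k => j * γ < a k)
    simp only [not_lt] at h
    exact_mod_cast h
  have hM : (1 - q) * J.card ≤ ((J.filter fun k => a k ≤ j * γ).card : ℝ) := by linarith
  rcases (J.filter fun k => (j + 2) * γ ≤ a k).eq_empty_or_nonempty with h0 | h0
  · rw [h0]; simp; positivity
  have h := hno (j + 1)
  have e1 : (((j + 1 : ℤ) : ℝ) + 1) * γ = (j + 2) * γ := by push_cast; ring
  have e2 : (((j + 1 : ℤ) : ℝ) - 1) * γ = j * γ := by push_cast; ring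
  unfold IsLargeSplit at h
  rw [e1, e2] at h
  have hMpos : (0 : ℝ) < ((J.filter fun k => a k ≤ j * γ).card : ℝ) := by
    refine lt_of_lt_of_le ?_ hM
    exact mul_pos (by linarith) hN
  have hMne : (J.filter fun k => a k ≤ j * γ).Nonempty :=
    Finset.card_pos.1 (by exact_mod_cast hMpos)
  have h' : √((J.filter fun k => (j + 2) * γ ≤ a k).card : ℝ)
      + √((J.filter fun k => a k ≤ j * γ).card : ℝ) < √(J.card : ℝ) := by
    by_contra hcon
    exact h ⟨h0, hMne, not_lt.1 hcon⟩
  have hsM : (1 - q) * √(J.card : ℝ) ≤ √((J.filter fun k => a k ≤ j * γ).card : ℝ) := by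
    apply Real.le_sqrt_of_sq_le
    rw [mul_pow, Real.sq_sqrt hN.le]
    refine le_trans ?_ hM
    apply mul_le_mul_of_nonneg_right _ hN.le
    nlinarith
  have hP : √((J.filter fun k => (j + 2) * γ ≤ a k).card : ℝ) ≤ q * √(J.card : ℝ) := by linarith
  have := pow_le_pow_left₀ (Real.sqrt_nonneg _) hP 2
  rwa [mul_pow, Real.sq_sqrt hN.le, Real.sq_sqrt (Nat.cast_nonneg _)] at this

/-- Without a large split, the upper tail contributes little to the first moment. The integer `R`
only serves to run an induction down from above all values. -/
lemma sum_upper_tail_le {J : Finset κ} {a : κ → ℝ} {γ : ℝ} (hγ : 0 < γ) (hJ : J.Nonempty)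
    (hno : ∀ j : ℤ, ¬ IsLargeSplit J a γ j) (R : ℕ) : ∀ (j : ℤ) (q : ℝ), 0 ≤ q → q ≤ 1 / 4 →
    ((J.filter fun k => j * γ < a k).card : ℝ) ≤ q * J.card →
    (∀ k ∈ J, a k ≤ (j + 2 * R) * γ) →
    ∑ k ∈ J, max (a k - j * γ) 0 ≤ 8 / 3 * γ * q * J.card := by
  induction R with
  | zero =>
    intro j q hq0 _ _ hle
    have : ∑ k ∈ J, max (a k - j * γ) 0 = 0 := by
      refine Finset.sum_eq_zero fun k hk => ?_
      have := hle k hk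
      simp only [Nat.cast_zero, mul_zero, add_zero] at this
      exact max_eq_right (by linarith)
    rw [this]
    positivity
  | succ R ih =>
    intro j q hq0 hq hU hle
    have hN : (0 : ℝ) ≤ J.card := Nat.cast_nonneg _
    have h1 := card_upper_le_sq hJ hno j hq0 (by linarith) hU
    have h2 : ((J.filter fun k => ((j + 2 : ℤ) : ℝ) * γ < a k).card : ℝ) ≤ q / 4 * J.card := by
      refine le_trans ?_ (h1.trans (mul_le_mul_of_nonneg_right (by nlinarith) hN))
      push_cast
      exact Nat.cast_le.2 (Finset.card_le_card
        (Finset.monotone_filter_right J fun k _ (hk : (j + 2) * γ < a k) => hk.le))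
    have h3 := ih (j + 2) (q / 4) (by linarith) (by linarith) h2 (fun k hk => by
      refine (hle k hk).trans (le_of_eq ?_)
      push_cast
      ring)
    have h4 : ∀ k ∈ J, max (a k - j * γ) 0 ≤
        (if j * γ < a k then 2 * γ else 0) + max (a k - ((j + 2 : ℤ) : ℝ) * γ) 0 := by
      intro k _
      push_cast
      have := le_max_left (a k - (j + 2) * γ) 0
      have := le_max_right (a k - (j + 2) * γ) 0
      split_ifs with h
      · exact max_le (by linarith) (by linarith)
      · exact max_le (by linarith) (by linarith)
    have h5 := Finset.sum_le_sum h4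
    rw [Finset.sum_add_distrib, ← Finset.sum_filter, Finset.sum_const, nsmul_eq_mul] at h5
    have h6 := mul_le_mul_of_nonneg_right hU (by linarith : 0 ≤ 2 * γ)
    nlinarith

/-- **Small deviation principle.** Values with mean pairwise distance at least `8γ` admit a large
split: otherwise all but a tiny part of them would lie in a window of length `5γ`. -/
lemma exists_isLargeSplit {J : Finset κ} {a : κ → ℝ} {γ : ℝ} (hγ : 0 < γ) (hJ : J.Nonempty)
    (hsep : 8 * γ * (J.card : ℝ) ^ 2 ≤ ∑ k ∈ J, ∑ l ∈ J, |a k - a l|) :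
    ∃ j : ℤ, IsLargeSplit J a γ j := by
  by_contra hcon
  have hno : ∀ j : ℤ, ¬ IsLargeSplit J a γ j := not_exists.1 hcon
  have hN : (0 : ℝ) < J.card := by exact_mod_cast hJ.card_pos
  obtain ⟨A, hA⟩ : ∃ A : ℕ, ∀ k ∈ J, |a k| ≤ A * γ := by
    obtain ⟨A, hA⟩ := exists_nat_ge ((∑ k ∈ J, |a k|) / γ)
    refine ⟨A, fun k hk => ?_⟩
    rw [div_le_iff₀ hγ] at hA
    exact (Finset.single_le_sum (f := fun k => |a k|) (fun _ _ => abs_nonneg _) hk).trans hA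
  -- `j₀γ` is a median of the values, rounded down to the grid
  obtain ⟨j₀, hj₀, hmax⟩ := Int.exists_greatest_of_bdd
    (P := fun j : ℤ => (J.card : ℝ) / 2 ≤ ((J.filter fun k => j * γ ≤ a k).card : ℝ))
    ⟨A, fun j hj => by
      by_contra hlt
      have hemp : (J.filter fun k => j * γ ≤ a k) = ∅ := by
        refine Finset.filter_eq_empty_iff.2 fun k hk hle => ?_
        have h1 := (abs_le.1 (hA k hk)).2
        have h2 : ((A : ℤ) : ℝ) < j := by exact_mod_cast not_le.1 hlt
        push_cast at h2
        nlinarith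
      rw [hemp] at hj
      simp only [Finset.card_empty, Nat.cast_zero] at hj
      linarith⟩
    ⟨-A, by
      have hall : (J.filter fun k => ((-A : ℤ) : ℝ) * γ ≤ a k) = J := by
        refine Finset.filter_true_of_mem fun k hk => ?_
        have h1 := (abs_le.1 (hA k hk)).1
        push_cast
        linarith
      rw [hall]
      linarith⟩
  have hA' : ∃ R : ℕ, ∀ k ∈ J, |a k| + |(j₀ : ℝ)| * γ + 4 * γ ≤ 2 * R * γ := by
    obtain ⟨R, hR⟩ := exists_nat_ge ((A : ℝ) + |(j₀ : ℝ)| + 4)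
    refine ⟨R, fun k hk => ?_⟩
    have := hA k hk
    nlinarith [abs_nonneg (j₀ : ℝ), mul_le_mul_of_nonneg_right hR hγ.le]
  obtain ⟨R, hR⟩ := hA'
  have hj₀γ : |(j₀ : ℝ) * γ| = |(j₀ : ℝ)| * γ := by rw [abs_mul, abs_of_pos hγ]
  -- the upper tail
  have hup1 : ((J.filter fun k => ((j₀ + 1 : ℤ) : ℝ) * γ < a k).card : ℝ) ≤ 1 / 2 * J.card := by
    have h1 : ¬ (J.card : ℝ) / 2 ≤
        ((J.filter fun k => ((j₀ + 1 : ℤ) : ℝ) * γ ≤ a k).card : ℝ) := fun h => by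
      have := hmax _ h
      omega
    have h2 : ((J.filter fun k => ((j₀ + 1 : ℤ) : ℝ) * γ < a k).card : ℝ) ≤
        ((J.filter fun k => ((j₀ + 1 : ℤ) : ℝ) * γ ≤ a k).card : ℝ) := by
      exact Nat.cast_le.2 (Finset.card_le_card
        (Finset.monotone_filter_right J fun k _ (hk : _ < _) => hk.le))
    linarith
  have hup2 := card_upper_le_sq hJ hno _ (by norm_num) le_rfl hup1
  have hup : ∑ k ∈ J, max (a k - ((j₀ + 3 : ℤ) : ℝ) * γ) 0 ≤ 8 / 3 * γ * (1 / 4) * J.card := by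
    refine sum_upper_tail_le hγ hJ hno R (j₀ + 3) (1 / 4) (by norm_num) le_rfl ?_ ?_
    · have h2 : ((J.filter fun k => ((j₀ + 3 : ℤ) : ℝ) * γ < a k).card : ℝ) ≤
          ((J.filter fun k => (((j₀ + 1 : ℤ) : ℝ) + 2) * γ ≤ a k).card : ℝ) := by
        refine Nat.cast_le.2 (Finset.card_le_card (Finset.monotone_filter_right J fun k _ hk => ?_))
        refine le_trans (le_of_eq ?_) hk.le
        push_cast
        ring
      linarith
    · intro k hk
      have h1 := hR k hk
      have h2 := le_abs_self (a k)
      have h3 := neg_abs_le ((j₀ : ℝ) * γ)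
      push_cast
      linarith
  -- the lower tail, which is the upper tail of the reflected values
  have hno' : ∀ j : ℤ, ¬ IsLargeSplit J (fun k => -a k) γ j := by
    intro j hj
    refine hno (-j) ?_
    have e1 : ∀ k, ((j : ℝ) + 1) * γ ≤ -a k ↔ a k ≤ (((-j : ℤ) : ℝ) - 1) * γ := fun k => by
      push_cast
      constructor <;> intro h <;> linarith
    have e2 : ∀ k, -a k ≤ ((j : ℝ) - 1) * γ ↔ (((-j : ℤ) : ℝ) + 1) * γ ≤ a k := fun k => by
      push_cast
      constructor <;> intro h <;> linarith
    unfold IsLargeSplit at hj ⊢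
    simp only [e1, e2] at hj
    exact ⟨hj.2.1, hj.1, by linarith [hj.2.2]⟩
  have hlo1 : ((J.filter fun k => ((-j₀ : ℤ) : ℝ) * γ < -a k).card : ℝ) ≤ 1 / 2 * J.card := by
    have h := Finset.card_filter_add_card_filter_not (s := J) (fun k => j₀ * γ ≤ a k)
    have h' : ((J.filter fun k => j₀ * γ ≤ a k).card : ℝ)
      + ((J.filter fun k => ¬ j₀ * γ ≤ a k).card : ℝ) = J.card := by exact_mod_cast h
    have e : (J.filter fun k => ((-j₀ : ℤ) : ℝ) * γ < -a k)
        = J.filter fun k => ¬ j₀ * γ ≤ a k := by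
      refine Finset.filter_congr fun k _ => ?_
      push_cast
      constructor <;> intro h <;> linarith
    rw [e]
    linarith
  have hlo2 := card_upper_le_sq hJ hno' _ (by norm_num) le_rfl hlo1
  have hlo : ∑ k ∈ J, max (-a k - ((-j₀ + 2 : ℤ) : ℝ) * γ) 0 ≤ 8 / 3 * γ * (1 / 4) * J.card := by
    refine sum_upper_tail_le hγ hJ hno' R (-j₀ + 2) (1 / 4) (by norm_num) le_rfl ?_ ?_
    · have h2 : ((J.filter fun k => ((-j₀ + 2 : ℤ) : ℝ) * γ < -a k).card : ℝ) ≤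
          ((J.filter fun k => (((-j₀ : ℤ) : ℝ) + 2) * γ ≤ -a k).card : ℝ) := by
        refine Nat.cast_le.2 (Finset.card_le_card (Finset.monotone_filter_right J fun k _ hk => ?_))
        refine le_trans (le_of_eq ?_) hk.le
        push_cast
        ring
      linarith
    · intro k hk
      have h1 := hR k hk
      have h2 := neg_abs_le (a k)
      have h3 := le_abs_self ((j₀ : ℝ) * γ)
      push_cast
      linarith
  -- all values outside the window `[(j₀ - 2)γ, (j₀ + 3)γ]` are charged to the tails
  set T : κ → ℝ := fun k =>
    max (a k - ((j₀ + 3 : ℤ) : ℝ) * γ) 0 + max (-a k - ((-j₀ + 2 : ℤ) : ℝ) * γ) 0 with hT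
  have hTsum : ∑ k ∈ J, T k ≤ 4 / 3 * γ * J.card := by
    rw [hT, Finset.sum_add_distrib]
    linarith
  have hpt : ∀ k l, |a k - a l| ≤ 5 * γ + T k + T l := by
    have key : ∀ k l, a k - a l ≤ 5 * γ + T k + T l := by
      intro k l
      have h1 := le_max_left (a k - ((j₀ + 3 : ℤ) : ℝ) * γ) 0
      have h2 := le_max_right (-a k - ((-j₀ + 2 : ℤ) : ℝ) * γ) 0
      have h3 := le_max_right (a l - ((j₀ + 3 : ℤ) : ℝ) * γ) 0
      have h4 := le_max_left (-a l - ((-j₀ + 2 : ℤ) : ℝ) * γ) 0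
      simp only [hT]
      push_cast at *
      linarith
    intro k l
    exact abs_le.2 ⟨by linarith [key l k], key k l⟩
  have hfin : ∑ k ∈ J, ∑ l ∈ J, |a k - a l| ≤ ∑ k ∈ J, ∑ l ∈ J, (5 * γ + T k + T l) :=
    Finset.sum_le_sum fun k _ => Finset.sum_le_sum fun l _ => hpt k l
  have heq : ∑ k ∈ J, ∑ l ∈ J, (5 * γ + T k + T l)
      = 5 * γ * (J.card : ℝ) ^ 2 + 2 * J.card * ∑ k ∈ J, T k := by
    simp only [Finset.sum_add_distrib, Finset.sum_const, nsmul_eq_mul, ← Finset.mul_sum]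
    ring
  have : 2 * (J.card : ℝ) * ∑ k ∈ J, T k ≤ 2 * J.card * (4 / 3 * γ * J.card) :=
    mul_le_mul_of_nonneg_left hTsum (by positivity)
  nlinarith [mul_pos hγ (pow_pos hN 2)]

/-! ### Counting shattered threshold patterns -/

/-- A partial assignment `ρ` of grid levels to coordinates is shattered by the family `(v k)_{k ∈ J}`
if every sign pattern is realised with margin `γ` around the prescribed levels; `none` marks the
coordinates without a threshold. -/
def GridShattered {p : ℕ} (J : Finset κ) (v : κ → ι → ℝ) (γ : ℝ) (ρ : ι → Option (Fin p)) : Prop :=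
  ∀ b : ι → Bool, ∃ k ∈ J, ∀ i j, ρ i = some j →
    (b i = true → ((j : ℕ) + 1) * γ ≤ v k i) ∧ (b i = false → v k i ≤ ((j : ℕ) - 1) * γ)

lemma GridShattered.mono {p : ℕ} {J K : Finset κ} (h : J ⊆ K) {v : κ → ι → ℝ} {γ : ℝ}
    {ρ : ι → Option (Fin p)} (hρ : GridShattered J v γ ρ) : GridShattered K v γ ρ := fun b =>
  let ⟨k, hk, hk'⟩ := hρ b
  ⟨k, h hk, hk'⟩

open Classical in
/-- A separated family of size `N` shatters at least `√N` patterns: split it along a coordinate,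
count in both halves, and count the patterns common to both once more with that coordinate
added. -/
lemma sqrt_card_le_card_gridShattered [Fintype ι] {p : ℕ} {v : κ → ι → ℝ} {γ : ℝ} (hγ : 0 < γ)
    (hp : 1 / γ ≤ p) (hv : ∀ k i, v k i ∈ Set.Icc (0 : ℝ) 1) (N : ℕ) :
    ∀ J : Finset κ, J.card = N → J.Nonempty →
    (∀ K ⊆ J, 2 ≤ K.card → ∃ i, 8 * γ * (K.card : ℝ) ^ 2 ≤ ∑ k ∈ K, ∑ l ∈ K, |v k i - v l i|) →
    √(J.card : ℝ) ≤
      ((Finset.univ.filter fun ρ : ι → Option (Fin p) => GridShattered J v γ ρ).card : ℝ) := by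
  induction N using Nat.strong_induction_on with
  | _ N ih =>
  intro J hJN hJ hsep
  rcases Nat.lt_or_ge J.card 2 with hlt | hge
  · have h1 : J.card = 1 := by
      have := hJ.card_pos
      omega
    obtain ⟨k, hk⟩ := hJ
    have : (Finset.univ.filter fun ρ : ι → Option (Fin p) => GridShattered J v γ ρ).Nonempty :=
      ⟨fun _ => none, by
        refine Finset.mem_filter.2 ⟨Finset.mem_univ _, fun b => ⟨k, hk, fun i j h => ?_⟩⟩
        simp at h⟩
    have := this.card_pos
    rw [h1]
    simpa using this
  obtain ⟨i, hi⟩ := hsep J subset_rfl hge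
  obtain ⟨j, hup, hlo, hsqrt⟩ := exists_isLargeSplit (a := fun k => v k i) hγ hJ hi
  set U := J.filter fun k => (j + 1) * γ ≤ v k i with hU
  set W := J.filter fun k => v k i ≤ (j - 1) * γ with hW
  -- the level of the split belongs to the grid `{0, …, p - 1}`
  obtain ⟨t, ht⟩ : ∃ t : Fin p, ((t : ℕ) : ℝ) = j := by
    obtain ⟨k, hk⟩ := hup
    obtain ⟨l, hl⟩ := hlo
    have h1 := (Finset.mem_filter.1 hk).2.trans (hv k i).2
    have h2 := (hv l i).1.trans (Finset.mem_filter.1 hl).2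
    have hj0 : (0 : ℝ) < j := by
      by_contra hneg
      nlinarith
    have hjp : (j : ℝ) < p := by
      rw [← le_div_iff₀ hγ] at h1
      linarith
    have hj0' : 0 ≤ j := by exact_mod_cast hj0.le
    lift j to ℕ using hj0'
    exact ⟨⟨j, by exact_mod_cast hjp⟩, by simp⟩
  have hdisj : ∀ k, k ∈ U → k ∈ W → False := by
    intro k hkU hkW
    have h1 := (Finset.mem_filter.1 hkU).2
    have h2 := (Finset.mem_filter.1 hkW).2
    nlinarith
  have hUlt : U.card < N := by
    obtain ⟨l, hl⟩ := hlo
    rw [← hJN]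
    exact Finset.card_lt_card (Finset.ssubset_iff_subset_ne.2 ⟨Finset.filter_subset _ _, fun h =>
      hdisj l (by rw [h]; exact (Finset.mem_filter.1 hl).1) hl⟩)
  have hWlt : W.card < N := by
    obtain ⟨l, hl⟩ := hup
    rw [← hJN]
    exact Finset.card_lt_card (Finset.ssubset_iff_subset_ne.2 ⟨Finset.filter_subset _ _, fun h =>
      hdisj l hl (by rw [h]; exact (Finset.mem_filter.1 hl).1)⟩)
  have ihU := ih _ hUlt U rfl hup fun K hK => hsep K (hK.trans (Finset.filter_subset _ _))
  have ihW := ih _ hWlt W rfl hlo fun K hK => hsep K (hK.trans (Finset.filter_subset _ _))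
  set A := Finset.univ.filter fun ρ : ι → Option (Fin p) => GridShattered U v γ ρ with hA
  set B := Finset.univ.filter fun ρ : ι → Option (Fin p) => GridShattered W v γ ρ with hB
  have hAt : ∀ ρ ∈ A, ∀ s, ρ i = some s → (j : ℝ) + 2 ≤ (s : ℕ) := by
    intro ρ hρ s hs
    obtain ⟨k, hk, hk'⟩ := (Finset.mem_filter.1 hρ).2 fun _ => false
    have h1 := (hk' i s hs).2 rfl
    have h2 := (Finset.mem_filter.1 hk).2
    have := le_of_mul_le_mul_right (h2.trans h1) hγ
    linarith
  have hBt : ∀ ρ ∈ B, ∀ s, ρ i = some s → ((s : ℕ) : ℝ) ≤ j - 2 := by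
    intro ρ hρ s hs
    obtain ⟨k, hk, hk'⟩ := (Finset.mem_filter.1 hρ).2 fun _ => true
    have h1 := (hk' i s hs).1 rfl
    have h2 := (Finset.mem_filter.1 hk).2
    have := le_of_mul_le_mul_right (h1.trans h2) hγ
    linarith
  have hnone : ∀ ρ ∈ A ∩ B, ρ i = none := by
    intro ρ hρ
    rw [Finset.mem_inter] at hρ
    by_contra hne
    obtain ⟨s, hs⟩ := Option.ne_none_iff_exists'.1 hne
    linarith [hAt ρ hρ.1 s hs, hBt ρ hρ.2 s hs]
  set f : (ι → Option (Fin p)) → ι → Option (Fin p) := fun ρ => Function.update ρ i (some t) with hf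
  have hinj : Set.InjOn f (A ∩ B : Finset (ι → Option (Fin p))) := by
    intro ρ hρ ρ' hρ' h
    funext i'
    by_cases hi' : i' = i
    · rw [hi', hnone ρ hρ, hnone ρ' hρ']
    · have := congrFun h i'
      simpa [hf, Function.update_of_ne hi'] using this
  have hdisj' : Disjoint (A ∪ B) ((A ∩ B).image f) := by
    rw [Finset.disjoint_left]
    intro ρ hρ hρ'
    obtain ⟨ρ₀, _, rfl⟩ := Finset.mem_image.1 hρ'
    have hfi : f ρ₀ i = some t := by simp [hf]
    rcases Finset.mem_union.1 hρ with h | h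
    · linarith [hAt _ h t hfi]
    · linarith [hBt _ h t hfi]
  have hsub : (A ∪ B) ∪ (A ∩ B).image f ⊆
      Finset.univ.filter fun ρ : ι → Option (Fin p) => GridShattered J v γ ρ := by
    intro ρ hρ
    refine Finset.mem_filter.2 ⟨Finset.mem_univ _, ?_⟩
    rcases Finset.mem_union.1 hρ with h | h
    · rcases Finset.mem_union.1 h with h | h
      · exact (Finset.mem_filter.1 h).2.mono (Finset.filter_subset _ _)
      · exact (Finset.mem_filter.1 h).2.mono (Finset.filter_subset _ _)
    · obtain ⟨ρ₀, hρ₀, rfl⟩ := Finset.mem_image.1 h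
      rw [Finset.mem_inter] at hρ₀
      intro b
      cases hb : b i with
      | true =>
        obtain ⟨k, hk, hk'⟩ := (Finset.mem_filter.1 hρ₀.1).2 b
        refine ⟨k, (Finset.mem_filter.1 hk).1, fun i' s hs => ?_⟩
        by_cases hi' : i' = i
        · subst hi'
          have hst : t = s := by simpa [hf] using hs
          subst hst
          rw [ht]
          exact ⟨fun _ => (Finset.mem_filter.1 hk).2, fun h => by simp [hb] at h⟩
        · exact hk' i' s (by simpa [hf, Function.update_of_ne hi'] using hs)
      | false =>
        obtain ⟨k, hk, hk'⟩ := (Finset.mem_filter.1 hρ₀.2).2 b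
        refine ⟨k, (Finset.mem_filter.1 hk).1, fun i' s hs => ?_⟩
        by_cases hi' : i' = i
        · subst hi'
          have hst : t = s := by simpa [hf] using hs
          subst hst
          rw [ht]
          exact ⟨fun h => by simp [hb] at h, fun _ => (Finset.mem_filter.1 hk).2⟩
        · exact hk' i' s (by simpa [hf, Function.update_of_ne hi'] using hs)
  have hcard := Finset.card_le_card hsub
  rw [Finset.card_union_of_disjoint hdisj', Finset.card_image_of_injOn hinj,
    Finset.card_union_add_card_inter] at hcard
  have hcard' : (A.card : ℝ) + B.card ≤
      ((Finset.univ.filter fun ρ : ι → Option (Fin p) => GridShattered J v γ ρ).card : ℝ) := by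
    exact_mod_cast hcard
  linarith

open Classical in
/-- The number of partial assignments with at most `D` values, bounded through the generating
function `(1 + px)^|ι|`. -/
lemma card_le_of_support_le [Fintype ι] {p D : ℕ} (𝒜 : Finset (ι → Option (Fin p)))
    (h𝒜 : ∀ ρ ∈ 𝒜, (Finset.univ.filter fun i => ρ i ≠ none).card ≤ D) {x : ℝ} (hx : 0 < x)
    (hx1 : x ≤ 1) : (𝒜.card : ℝ) ≤ (x⁻¹) ^ D * (1 + p * x) ^ Fintype.card ι := by
  have h1 : ∑ ρ : ι → Option (Fin p), ∏ i, (if ρ i ≠ none then x else 1)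
      = (1 + p * x) ^ Fintype.card ι := by
    have := Finset.prod_univ_sum (fun _ : ι => (Finset.univ : Finset (Option (Fin p))))
      (fun _ o => if o ≠ none then x else (1 : ℝ))
    rw [Fintype.piFinset_univ] at this
    rw [← this]
    simp [Fintype.sum_option]
  have h2 : (𝒜.card : ℝ) * x ^ D ≤ (1 + p * x) ^ Fintype.card ι := by
    rw [← h1, ← nsmul_eq_mul]
    refine le_trans (Finset.card_nsmul_le_sum 𝒜 (fun ρ => ∏ i, (if ρ i ≠ none then x else 1)) _
      fun ρ hρ => ?_) (Finset.sum_le_sum_of_subset_of_nonneg (Finset.subset_univ _)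
        fun ρ _ _ => Finset.prod_nonneg fun i _ => by split_ifs <;> linarith)
    rw [Finset.prod_ite, Finset.prod_const, Finset.prod_const_one, mul_one]
    exact pow_le_pow_of_le_one hx.le hx1 (h𝒜 ρ hρ)
  rw [inv_pow, inv_mul_eq_div, le_div_iff₀ (pow_pos hx D)]
  exact h2

end Combinatorics

/-! ### Empirical `L¹` covers of classes of finite fat-shattering dimension -/

section Covers

variable {α : Type*}

/-- The mean distance `(1/q) ∑ |g(z_l) - h(z_l)|` of two functions on the points `z`. -/
noncomputable def meanDist {q : ℕ} (g h : α → ℝ) (z : Fin q → α) : ℝ := (∑ l, |g (z l) - h (z l)|) / q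

/-- The covering number bound at `q` points, for fat-shattering dimension `D` and `p` threshold
levels; `x` is a free parameter trading the two factors against each other. -/
noncomputable def coverBound (D p q : ℕ) (x : ℝ) : ℝ := ((x⁻¹) ^ D * (1 + p * x) ^ q) ^ 2

open Classical in
/-- Separated families in empirical `L¹` distance are small. -/
lemma card_packing_le {F : Set (α → ℝ)} (hF : ∀ f ∈ F, ∀ x, f x ∈ Set.Icc (0 : ℝ) 1) {γ : ℝ}
    (hγ : 0 < γ) {D : ℕ} (hD : ∀ S, FatShatters F γ S → S.card ≤ D) {f : ℕ → α → ℝ}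
    (hf : ∀ i, f i ∈ F) {q : ℕ} (z : Fin q → α) {J : Finset ℕ}
    (hJ : ∀ i ∈ J, ∀ j ∈ J, i ≠ j → 16 * γ < meanDist (f i) (f j) z) {x : ℝ} (hx : 0 < x)
    (hx1 : x ≤ 1) {p : ℕ} (hp : 1 / γ ≤ p) : (J.card : ℝ) ≤ coverBound D p q x := by
  rcases J.eq_empty_or_nonempty with rfl | hne
  · simp only [Finset.card_empty, Nat.cast_zero, coverBound]; positivity
  -- repeated sample points are merged, so that shattered coordinates are distinct points
  set Z : Finset α := Finset.univ.image z with hZ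
  set v : ℕ → Z → ℝ := fun k i => f k i.1 with hv
  have hsep : ∀ K ⊆ J, 2 ≤ K.card →
      ∃ i, 8 * γ * (K.card : ℝ) ^ 2 ≤ ∑ k ∈ K, ∑ l ∈ K, |v k i - v l i| := by
    intro K hKJ hK
    have hK' : (2 : ℝ) ≤ K.card := by exact_mod_cast hK
    have hq : 0 < q := by
      rcases Nat.eq_zero_or_pos q with rfl | h
      · obtain ⟨a, ha, b, hb, hab⟩ := Finset.one_lt_card.1 hK
        have := hJ a (hKJ ha) b (hKJ hb) hab
        simp only [meanDist, CharP.cast_eq_zero, div_zero] at this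
        linarith
      · exact h
    have hq' : (0 : ℝ) < q := by exact_mod_cast hq
    have h1 : ∑ k ∈ K, ∑ l ∈ K, (if k = l then 0 else 16 * γ)
        ≤ ∑ k ∈ K, ∑ l ∈ K, meanDist (f k) (f l) z := by
      refine Finset.sum_le_sum fun k hk => Finset.sum_le_sum fun l hl => ?_
      split_ifs with h
      · exact div_nonneg (Finset.sum_nonneg fun _ _ => abs_nonneg _) hq'.le
      · exact (hJ k (hKJ hk) l (hKJ hl) h).le
    have h2 : ∑ k ∈ K, ∑ l ∈ K, (if k = l then 0 else 16 * γ)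
        = 16 * γ * ((K.card : ℝ) ^ 2 - K.card) := by
      have : ∀ k ∈ K, ∑ l ∈ K, (if k = l then 0 else 16 * γ) = 16 * γ * (K.card - 1) := by
        intro k hk
        have : ∀ l, (if k = l then 0 else 16 * γ) = 16 * γ - if k = l then 16 * γ else 0 := by
          intro l; split_ifs <;> ring
        simp only [this, Finset.sum_sub_distrib, Finset.sum_const, nsmul_eq_mul,
          Finset.sum_ite_eq, hk, if_true]
        ring
      rw [Finset.sum_congr rfl this, Finset.sum_const, nsmul_eq_mul]
      ring
    have h3 : ∑ k ∈ K, ∑ l ∈ K, meanDist (f k) (f l) z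
        = (∑ m, ∑ k ∈ K, ∑ l ∈ K, |f k (z m) - f l (z m)|) / q := by
      simp only [meanDist, ← Finset.sum_div]
      congr 1
      refine Eq.symm ?_
      rw [Finset.sum_comm]
      refine Finset.sum_congr rfl fun k _ => ?_
      rw [Finset.sum_comm]
    have h4 : (Finset.univ : Finset (Fin q)).Nonempty := ⟨⟨0, hq⟩, Finset.mem_univ _⟩
    obtain ⟨m, _, hm⟩ := Finset.exists_le_of_sum_le h4
      (f := fun _ : Fin q => 8 * γ * (K.card : ℝ) ^ 2)
      (g := fun m => ∑ k ∈ K, ∑ l ∈ K, |f k (z m) - f l (z m)|) (by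
        rw [h2, h3, le_div_iff₀ hq'] at h1
        rw [Finset.sum_const, nsmul_eq_mul, Finset.card_univ, Fintype.card_fin]
        refine le_trans ?_ h1
        have : 8 * γ * (K.card : ℝ) ^ 2 ≤ 16 * γ * ((K.card : ℝ) ^ 2 - K.card) := by
          have : 0 ≤ γ * (K.card * ((K.card : ℝ) - 2)) :=
            mul_nonneg hγ.le (mul_nonneg (by linarith) (by linarith))
          nlinarith
        nlinarith)
    exact ⟨⟨z m, Finset.mem_image_of_mem z (Finset.mem_univ m)⟩, hm⟩
  have h1 := sqrt_card_le_card_gridShattered (p := p) (v := v) hγ hp (fun k i => hF _ (hf k) _)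
    J.card J rfl hne hsep
  have h2 := h1.trans (card_le_of_support_le (D := D) _ (by
      intro ρ hρ
      have hρ' := (Finset.mem_filter.1 hρ).2
      have hS := hD ((Finset.univ.filter fun i => ρ i ≠ none).image Subtype.val) ?_
      · rwa [Finset.card_image_of_injective _ Subtype.val_injective] at hS
      refine ⟨fun a => if h : a ∈ Z then ((ρ ⟨a, h⟩).elim 0 fun j => ((j : ℕ) : ℝ)) * γ else 0,
        fun b hb => ?_⟩
      obtain ⟨k, _, hk⟩ := hρ' fun i => decide (b i.1 = 1)
      refine ⟨f k, hf k, fun s hs => ?_⟩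
      obtain ⟨i, hi, rfl⟩ := Finset.mem_image.1 hs
      obtain ⟨j, hj⟩ := Option.ne_none_iff_exists'.1 (Finset.mem_filter.1 hi).2
      have hki := hk i j hj
      simp only [i.2, dif_pos, Subtype.coe_eta, hj, Option.elim_some]
      rcases hb i.1 hs with h | h
      · have := hki.1 (by simp [h])
        simp only [hv] at this
        rw [h]
        linarith
      · have := hki.2 (by simp [h]; norm_num)
        simp only [hv] at this
        rw [h]
        linarith) hx hx1)
  have hZq : Fintype.card Z ≤ q := by
    rw [Fintype.card_coe]
    exact Finset.card_image_le.trans (by simp)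
  have h3 : √(J.card : ℝ) ≤ (x⁻¹) ^ D * (1 + p * x) ^ q := by
    refine h2.trans (mul_le_mul_of_nonneg_left ?_ (by positivity))
    exact pow_le_pow_right₀ (by linarith [mul_nonneg (Nat.cast_nonneg (α := ℝ) p) hx.le]) hZq
  have h4 := pow_le_pow_left₀ (Real.sqrt_nonneg _) h3 2
  rwa [Real.sq_sqrt (Nat.cast_nonneg _)] at h4

/-- A sequence of functions from a class of finite fat-shattering dimension has small finite
covers in empirical `L¹` distance: take a maximal separated set. -/
lemma exists_cover {F : Set (α → ℝ)} (hF : ∀ f ∈ F, ∀ x, f x ∈ Set.Icc (0 : ℝ) 1) {γ : ℝ}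
    (hγ : 0 < γ) {D : ℕ} (hD : ∀ S, FatShatters F γ S → S.card ≤ D) {f : ℕ → α → ℝ}
    (hf : ∀ i, f i ∈ F) {q : ℕ} (z : Fin q → α) {x : ℝ} (hx : 0 < x) (hx1 : x ≤ 1) {p : ℕ}
    (hp : 1 / γ ≤ p) : ∃ J : Finset ℕ, (J.card : ℝ) ≤ coverBound D p q x ∧
      ∀ i, ∃ j ∈ J, meanDist (f i) (f j) z ≤ 16 * γ := by
  classical
  let Pk : Finset ℕ → Prop := fun J =>
    ∀ i ∈ J, ∀ j ∈ J, i ≠ j → 16 * γ < meanDist (f i) (f j) z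
  have hbd : ∀ J, Pk J → J.card ≤ ⌊coverBound D p q x⌋₊ := fun J hJ =>
    Nat.le_floor (card_packing_le hF hγ hD hf z hJ hx hx1 hp)
  let Q : ℕ → Prop := fun m => ∃ J, Pk J ∧ J.card = m
  have hQ0 : Q 0 := ⟨∅, by simp [Pk], rfl⟩
  obtain ⟨J, hJ, hJc⟩ : Q (Nat.findGreatest Q ⌊coverBound D p q x⌋₊) :=
    Nat.findGreatest_spec (Nat.zero_le _) hQ0
  refine ⟨J, card_packing_le hF hγ hD hf z hJ hx hx1 hp, fun i => ?_⟩
  by_contra hcon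
  push Not at hcon
  have hself : meanDist (f i) (f i) z = 0 := by simp [meanDist]
  have hi : i ∉ J := fun h => by
    have := hcon i h
    rw [hself] at this
    linarith
  have hsymm : ∀ g h : α → ℝ, meanDist g h z = meanDist h g z := fun g h => by
    simp only [meanDist, abs_sub_comm]
  have hins : Pk (insert i J) := by
    intro a ha b hb hab
    rcases Finset.mem_insert.1 ha with rfl | ha' <;> rcases Finset.mem_insert.1 hb with rfl | hb'
    · exact absurd rfl hab
    · exact hcon b hb'
    · rw [hsymm]; exact hcon a ha'
    · exact hJ a ha' b hb' hab
  have h1 := Nat.le_findGreatest (P := Q) (hbd _ hins) ⟨_, hins, rfl⟩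
  rw [← hJc, Finset.card_insert_of_notMem hi] at h1
  omega

end Covers

/-! ### Concentration and products -/

section Concentration

variable {Ω : Type*} [MeasurableSpace Ω]

/-- **Hoeffding's inequality** for independent coordinates of a product measure. -/
lemma measure_sum_sub_integral_ge_le {ι : Type*} [Fintype ι] (μ : ι → Measure Ω)
    [∀ i, IsProbabilityMeasure (μ i)] {g : ι → Ω → ℝ} (hg : ∀ i, Measurable (g i)) {K : ℝ}
    (hK : ∀ i, ∀ᵐ ω ∂μ i, g i ω ∈ Set.Icc (-K) K) {t : ℝ} (ht : 0 ≤ t) :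
    (Measure.pi μ).real {S | t ≤ ∑ i, (g i (S i) - ∫ ω, g i ω ∂μ i)}
      ≤ Real.exp (-t ^ 2 / (2 * (Fintype.card ι * K ^ 2))) := by
  have hind : iIndepFun (fun i (S : ι → Ω) => g i (S i) - ∫ ω, g i ω ∂μ i) (Measure.pi μ) :=
    iIndepFun_pi (X := fun i ω => g i ω - ∫ ω, g i ω ∂μ i)
      fun i => ((hg i).sub measurable_const).aemeasurable
  have hsub : ∀ i ∈ (Finset.univ : Finset ι),
      HasSubgaussianMGF (fun (S : ι → Ω) => g i (S i) - ∫ ω, g i ω ∂μ i)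
        ((‖K - -K‖₊ / 2) ^ 2) (Measure.pi μ) := by
    intro i _
    have h : HasSubgaussianMGF (fun ω => g i ω - ∫ ω, g i ω ∂μ i) ((‖K - -K‖₊ / 2) ^ 2)
        ((Measure.pi μ).map fun S : ι → Ω => S i) := by
      have e : ((Measure.pi μ).map fun S : ι → Ω => S i) = μ i :=
        (measurePreserving_eval μ i).map_eq
      rw [e]
      exact hasSubgaussianMGF_of_mem_Icc (hg i).aemeasurable (hK i)
    exact HasSubgaussianMGF.of_map (Y := fun S : ι → Ω => S i) (measurable_pi_apply i).aemeasurable h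
  have h := HasSubgaussianMGF.measure_sum_ge_le_of_iIndepFun hind hsub ht
  refine h.trans (le_of_eq ?_)
  congr 2
  rw [Finset.sum_const, Finset.card_univ, nsmul_eq_mul]
  push_cast
  rw [show K - -K = 2 * K by ring, Real.norm_eq_abs, abs_mul, abs_two,
    mul_div_cancel_left₀ _ (two_ne_zero), sq_abs]

/-- Two-sided Hoeffding inequality for the empirical mean of `m` independent samples. -/
lemma measure_abs_mean_sub_integral_ge_le (μ : Measure Ω) [IsProbabilityMeasure μ] {g : Ω → ℝ}
    (hg : Measurable g) {K : ℝ} (hK : ∀ᵐ ω ∂μ, g ω ∈ Set.Icc (-K) K) {m : ℕ} (hm : 0 < m) {t : ℝ}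
    (ht : 0 ≤ t) :
    (Measure.pi fun _ : Fin m => μ).real {S | t ≤ |(∑ i, g (S i)) / m - ∫ ω, g ω ∂μ|}
      ≤ 2 * Real.exp (-(m * t ^ 2 / (2 * K ^ 2))) := by
  have hm' : (0 : ℝ) < m := by exact_mod_cast hm
  have h1 := measure_sum_sub_integral_ge_le (fun _ : Fin m => μ) (g := fun _ => g) (fun _ => hg)
    (fun _ => hK) (t := m * t) (by positivity)
  have h2 := measure_sum_sub_integral_ge_le (fun _ : Fin m => μ) (g := fun _ ω => -g ω)
    (fun _ => hg.neg) (K := K) (fun _ => by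
      filter_upwards [hK] with ω hω
      exact ⟨by linarith [hω.2], by linarith [hω.1]⟩) (t := m * t) (by positivity)
  have hexp : -(m * t) ^ 2 / (2 * (Fintype.card (Fin m) * K ^ 2)) = -(m * t ^ 2 / (2 * K ^ 2)) := by
    rw [Fintype.card_fin]
    rcases eq_or_ne K 0 with rfl | hK0
    · simp
    · field_simp
  rw [hexp] at h1 h2
  have hsub : {S : Fin m → Ω | t ≤ |(∑ i, g (S i)) / m - ∫ ω, g ω ∂μ|} ⊆
      {S | m * t ≤ ∑ i, (g (S i) - ∫ ω, g ω ∂μ)} ∪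
        {S | m * t ≤ ∑ i, (-g (S i) - ∫ ω, -g ω ∂μ)} := by
    intro S hS
    have e : (∑ i, g (S i)) / m - ∫ ω, g ω ∂μ = (∑ i, (g (S i) - ∫ ω, g ω ∂μ)) / m := by
      rw [Finset.sum_sub_distrib, Finset.sum_const, Finset.card_univ, Fintype.card_fin,
        nsmul_eq_mul]
      field_simp
    rw [Set.mem_ofPred_eq, e] at hS
    rcases le_abs.1 hS with h | h
    · left
      rw [le_div_iff₀ hm'] at h
      simp only [Set.mem_ofPred_eq]
      linarith
    · right
      rw [← neg_div, le_div_iff₀ hm', ← Finset.sum_neg_distrib] at h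
      simp only [Set.mem_ofPred_eq, integral_neg]
      refine le_trans (by linarith) (h.trans (Finset.sum_le_sum fun i _ => by linarith))
  calc _ ≤ _ := measureReal_mono hsub
    _ ≤ _ := measureReal_union_le _ _
    _ ≤ _ := by linarith

/-- Concatenation identifies the product of two powers of a measure with the joint power. -/
lemma measurePreserving_append (μ : Measure Ω) [IsProbabilityMeasure μ] (a b : ℕ) :
    MeasurePreserving (fun z : (Fin a → Ω) × (Fin b → Ω) => Fin.append z.1 z.2)
      ((Measure.pi fun _ : Fin a => μ).prod (Measure.pi fun _ : Fin b => μ))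
      (Measure.pi fun _ : Fin (a + b) => μ) := by
  have hmeas : Measurable (fun z : (Fin a → Ω) × (Fin b → Ω) => Fin.append z.1 z.2) := by
    refine measurable_pi_iff.2 fun i => ?_
    refine Fin.addCases (fun i => ?_) (fun i => ?_) i
    · simp only [Fin.append_left]; fun_prop
    · simp only [Fin.append_right]; fun_prop
  refine ⟨hmeas, (Measure.pi_eq fun s hs => ?_).symm⟩
  rw [Measure.map_apply hmeas (MeasurableSet.univ_pi hs)]
  have : (fun z : (Fin a → Ω) × (Fin b → Ω) => Fin.append z.1 z.2) ⁻¹' Set.univ.pi s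
      = (Set.univ.pi fun i => s (Fin.castAdd b i)) ×ˢ (Set.univ.pi fun i => s (Fin.natAdd a i)) := by
    ext z
    simp only [Set.mem_preimage, Set.mem_univ_pi, Set.mem_prod]
    constructor
    · intro h
      exact ⟨fun i => by simpa using h (Fin.castAdd b i), fun i => by simpa using h (Fin.natAdd a i)⟩
    · intro h i
      refine Fin.addCases (fun i => ?_) (fun i => ?_) i
      · simpa using h.1 i
      · simpa using h.2 i
  rw [this, Measure.prod_prod, Measure.pi_pi, Measure.pi_pi, Fin.prod_univ_add]

/-- A union bound in two stages: outside the event `E` on the first factor, all sections of `A`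
have small probability. -/
lemma prod_real_le_add {Ω' : Type*} [MeasurableSpace Ω'] (μ : Measure Ω) [IsProbabilityMeasure μ]
    (ν : Measure Ω') [IsProbabilityMeasure ν] {A : Set (Ω × Ω')} (hA : MeasurableSet A) {E : Set Ω}
    {δ₁ δ₂ : ℝ} (hδ₂ : 0 ≤ δ₂) (hE : μ.real E ≤ δ₁)
    (h : ∀ x ∉ E, ν.real {y | (x, y) ∈ A} ≤ δ₂) : (μ.prod ν).real A ≤ δ₁ + δ₂ := by
  have hδ₁ : 0 ≤ δ₁ := measureReal_nonneg.trans hE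
  refine ENNReal.toReal_le_of_le_ofReal (by linarith) ?_
  rw [Measure.prod_apply hA, ENNReal.ofReal_add hδ₁ hδ₂]
  have hE' : μ (toMeasurable μ E) ≤ ENNReal.ofReal δ₁ := by
    rw [measure_toMeasurable]
    exact (ENNReal.le_ofReal_iff_toReal_le (measure_ne_top _ _) hδ₁).2 hE
  calc ∫⁻ x, ν (Prod.mk x ⁻¹' A) ∂μ
      ≤ ∫⁻ x, ((toMeasurable μ E).indicator 1 x + ENNReal.ofReal δ₂) ∂μ := by
        refine lintegral_mono fun x => ?_
        by_cases hx : x ∈ E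
        · rw [Set.indicator_of_mem (subset_toMeasurable μ E hx)]
          exact prob_le_one.trans le_self_add
        · refine le_trans ?_ le_add_self
          exact (ENNReal.le_ofReal_iff_toReal_le (measure_ne_top _ _) hδ₂).2 (h x hx)
    _ = μ (toMeasurable μ E) + ENNReal.ofReal δ₂ := by
        rw [lintegral_add_right _ measurable_const,
          lintegral_indicator_one (measurableSet_toMeasurable μ E)]
        simp
    _ ≤ _ := by gcongr

end Concentration

/-! ### Symmetrization -/

section Symmetrization

variable {α : Type*}

/-- Exchange the two entries of the pairs selected by `σ`. -/
def swapPairs {m : ℕ} (σ : Fin m → Bool) (w : Fin m → α × α) : Fin m → α × α :=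
  fun l => if σ l then (w l).swap else w l

/-- Random signs rarely make the empirical means over the two halves of a double sample differ
much, uniformly over a class with small covers on that double sample. -/
lemma measure_swapPairs_le {h : ℕ → α → ℝ} (h01 : ∀ i x, h i x ∈ Set.Icc (0 : ℝ) 1) {m : ℕ}
    (hm : 0 < m) {t τ ρ N : ℝ} (hτ : 0 ≤ τ) (hρ : τ + 2 * t ≤ ρ) (w : Fin m → α × α)
    {J : Finset ℕ} (hJN : (J.card : ℝ) ≤ N)
    (hJ : ∀ i, ∃ j ∈ J,
      ∑ l, (|h i (w l).1 - h j (w l).1| + |h i (w l).2 - h j (w l).2|) ≤ 2 * m * t) :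
    (Measure.pi fun _ : Fin m => (PMF.uniformOfFintype Bool).toMeasure).real
      {σ | ∃ i, m * ρ ≤ ∑ l, (h i (swapPairs σ w l).2 - h i (swapPairs σ w l).1)}
      ≤ N * Real.exp (-(m * τ ^ 2 / 2)) := by
  have hm' : (0 : ℝ) < m := by exact_mod_cast hm
  set β := (PMF.uniformOfFintype Bool).toMeasure with hβ
  set g : ℕ → Fin m → Bool → ℝ := fun j l b =>
    if b then h j (w l).1 - h j (w l).2 else h j (w l).2 - h j (w l).1 with hg
  have hgint : ∀ j l, ∫ b, g j l b ∂β = 0 := by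
    intro j l
    rw [hβ, PMF.integral_eq_sum]
    simp [hg]
    ring
  have hsub : {σ : Fin m → Bool | ∃ i,
      m * ρ ≤ ∑ l, (h i (swapPairs σ w l).2 - h i (swapPairs σ w l).1)} ⊆
      ⋃ j ∈ J, {σ | m * τ ≤ ∑ l, (g j l (σ l) - ∫ b, g j l b ∂β)} := by
    rintro σ ⟨i, hi⟩
    obtain ⟨j, hj, hij⟩ := hJ i
    simp only [Set.mem_iUnion]
    refine ⟨j, hj, ?_⟩
    simp only [Set.mem_ofPred_eq, hgint, sub_zero]
    have h1 : ∀ l, (h i (swapPairs σ w l).2 - h i (swapPairs σ w l).1) - g j l (σ l)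
        ≤ |h i (w l).1 - h j (w l).1| + |h i (w l).2 - h j (w l).2| := by
      intro l
      have a1 := abs_le.1 (le_refl |h i (w l).1 - h j (w l).1|)
      have a2 := abs_le.1 (le_refl |h i (w l).2 - h j (w l).2|)
      simp only [swapPairs, hg]
      cases σ l
      · simp; linarith [a1.1, a1.2, a2.1, a2.2]
      · simp; linarith [a1.1, a1.2, a2.1, a2.2]
    have h2 := Finset.sum_le_sum fun l (_ : l ∈ Finset.univ) => h1 l
    rw [Finset.sum_sub_distrib] at h2
    have h3 : (m : ℝ) * (τ + 2 * t) ≤ m * ρ := mul_le_mul_of_nonneg_left hρ hm'.le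
    linarith
  have hone : ∀ j, (Measure.pi fun _ : Fin m => β).real
      {σ | m * τ ≤ ∑ l, (g j l (σ l) - ∫ b, g j l b ∂β)} ≤ Real.exp (-(m * τ ^ 2 / 2)) := by
    intro j
    refine (measure_sum_sub_integral_ge_le (fun _ : Fin m => β) (g := g j)
      (fun _ => measurable_of_finite _) (K := 1) (fun l => Filter.Eventually.of_forall fun b => ?_)
      (by positivity)).trans (le_of_eq ?_)
    · have a1 := h01 j (w l).1
      have a2 := h01 j (w l).2
      simp only [hg]
      split_ifs <;> constructor <;> linarith [a1.1, a1.2, a2.1, a2.2]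
    · rw [Fintype.card_fin]
      congr 1
      field_simp
  calc _ ≤ _ := measureReal_mono hsub (measure_ne_top _ _)
    _ ≤ _ := measureReal_biUnion_finset_le J _
    _ ≤ ∑ j ∈ J, Real.exp (-(m * τ ^ 2 / 2)) := Finset.sum_le_sum fun j _ => hone j
    _ = J.card * Real.exp (-(m * τ ^ 2 / 2)) := by rw [Finset.sum_const, nsmul_eq_mul]
    _ ≤ _ := mul_le_mul_of_nonneg_right hJN (Real.exp_pos _).le

variable [MeasurableSpace α]

lemma measurePreserving_swapPairs (μ : Measure α) [IsProbabilityMeasure μ] {m : ℕ}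
    (σ : Fin m → Bool) :
    MeasurePreserving (swapPairs σ) (Measure.pi fun _ : Fin m => μ.prod μ)
      (Measure.pi fun _ : Fin m => μ.prod μ) := by
  refine measurePreserving_pi (fun _ : Fin m => μ.prod μ) (fun _ : Fin m => μ.prod μ)
    (f := fun l (x : α × α) => if σ l then x.swap else x) fun l => ?_
  cases σ l
  · exact MeasurePreserving.id (μ.prod μ)
  · simpa using Measure.measurePreserving_swap (μ := μ) (ν := μ)

/-- **Symmetrization.** Uniformly over a countable class with small covers on double samples, a
small empirical mean forces a small expectation. -/
lemma measure_exists_mean_le_lt_integral_le (μ : Measure α) [IsProbabilityMeasure μ]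
    {h : ℕ → α → ℝ} (hmeas : ∀ i, Measurable (h i)) (h01 : ∀ i x, h i x ∈ Set.Icc (0 : ℝ) 1)
    {m : ℕ} (hm : 0 < m) {r s v t τ N : ℝ} (hv : 0 ≤ v) (hτ : 0 ≤ τ) (hN : 0 ≤ N)
    (hgap : τ + 2 * t ≤ s - v - r) (hhalf : 2 * Real.exp (-(m * v ^ 2 / 2)) ≤ 1 / 2)
    (hcover : ∀ w : Fin m → α × α, ∃ J : Finset ℕ, (J.card : ℝ) ≤ N ∧ ∀ i, ∃ j ∈ J,
      ∑ l, (|h i (w l).1 - h j (w l).1| + |h i (w l).2 - h j (w l).2|) ≤ 2 * m * t) :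
    (Measure.pi fun _ : Fin m => μ).real
      {S | ∃ i, (∑ l, h i (S l)) / m ≤ r ∧ s < ∫ x, h i x ∂μ}
      ≤ 2 * (N * Real.exp (-(m * τ ^ 2 / 2))) := by
  have hm' : (0 : ℝ) < m := by exact_mod_cast hm
  set P := Measure.pi fun _ : Fin m => μ with hP
  set E := {S : Fin m → α | ∃ i, (∑ l, h i (S l)) / m ≤ r ∧ s < ∫ x, h i x ∂μ} with hE
  set A := {z : (Fin m → α) × (Fin m → α) |
    ∃ i, (∑ l, h i (z.1 l)) / m ≤ r ∧ s - v < (∑ l, h i (z.2 l)) / m} with hA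
  have hEm : MeasurableSet E := by
    rw [hE, Set.ofPred_exists]
    refine MeasurableSet.iUnion fun i => ?_
    rw [Set.ofPred_and]
    have := hmeas i
    exact (measurableSet_le (by fun_prop) measurable_const).inter (MeasurableSet.const _)
  have hAm : MeasurableSet A := by
    rw [hA, Set.ofPred_exists]
    refine MeasurableSet.iUnion fun i => ?_
    rw [Set.ofPred_and]
    have := hmeas i
    refine (measurableSet_le ?_ measurable_const).inter (measurableSet_lt measurable_const ?_) <;>
      fun_prop
  -- a ghost sample confirms, with probability at least one half, a large expectation
  have hghost : ∀ S ∈ E, ENNReal.ofReal (1 / 2) ≤ P (Prod.mk S ⁻¹' A) := by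
    rintro S ⟨i, hi1, hi2⟩
    have hconc := measure_abs_mean_sub_integral_ge_le μ (hmeas i) (K := 1)
      (Filter.Eventually.of_forall fun x => ⟨by linarith [(h01 i x).1], (h01 i x).2⟩) hm hv
    simp only [one_pow, mul_one] at hconc
    have hsub : (Prod.mk S ⁻¹' A)ᶜ ⊆
        {S' : Fin m → α | v ≤ |(∑ l, h i (S' l)) / m - ∫ x, h i x ∂μ|} := by
      intro S' hS'
      have : ¬ s - v < (∑ l, h i (S' l)) / m := fun hlt => hS' ⟨i, hi1, hlt⟩
      simp only [Set.mem_ofPred_eq]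
      rw [abs_sub_comm]
      exact le_trans (by linarith) (le_abs_self _)
    have h1 := (measureReal_mono (μ := P) hsub).trans (hconc.trans hhalf)
    rw [probReal_compl_eq_one_sub (measurable_prodMk_left hAm)] at h1
    rw [ENNReal.ofReal_le_iff_le_toReal (measure_ne_top _ _)]
    change 1 / 2 ≤ P.real (Prod.mk S ⁻¹' A)
    linarith
  have hstep1 : P.real E ≤ 2 * (P.prod P).real A := by
    have h1 : ENNReal.ofReal (1 / 2) * P E ≤ (P.prod P) A := by
      rw [Measure.prod_apply hAm]
      calc ENNReal.ofReal (1 / 2) * P E = ∫⁻ S in E, ENNReal.ofReal (1 / 2) ∂P := by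
            rw [setLIntegral_const]
        _ ≤ ∫⁻ S in E, P (Prod.mk S ⁻¹' A) ∂P :=
            setLIntegral_mono' hEm fun S hS => hghost S hS
        _ ≤ _ := setLIntegral_le_lintegral _ _
    have h2 := ENNReal.toReal_mono (measure_ne_top _ _) h1
    rw [ENNReal.toReal_mul, ENNReal.toReal_ofReal (by norm_num)] at h2
    change 1 / 2 * P.real E ≤ (P.prod P).real A at h2
    linarith
  -- arrange the double sample in pairs, and swap them at random
  set Q := Measure.pi fun _ : Fin m => μ.prod μ with hQ
  set A' := {w : Fin m → α × α |
    ∃ i, (∑ l, h i (w l).1) / m ≤ r ∧ s - v < (∑ l, h i (w l).2) / m} with hA'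
  have hA'm : MeasurableSet A' := by
    rw [hA', Set.ofPred_exists]
    refine MeasurableSet.iUnion fun i => ?_
    rw [Set.ofPred_and]
    have := hmeas i
    refine (measurableSet_le ?_ measurable_const).inter (measurableSet_lt measurable_const ?_) <;>
      fun_prop
  have hstep2 : (P.prod P).real A = Q.real A' := by
    have h1 := (measurePreserving_arrowProdEquivProdArrow α α (Fin m) (fun _ => μ)
      (fun _ => μ)).measure_preimage hAm.nullMeasurableSet
    have h2 : (MeasurableEquiv.arrowProdEquivProdArrow α α (Fin m)) ⁻¹' A = A' := rfl
    rw [h2] at h1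
    rw [measureReal_def, measureReal_def, ← h1]
  set β := Measure.pi fun _ : Fin m => (PMF.uniformOfFintype Bool).toMeasure with hβ
  have hAJ : MeasurableSet {y : (Fin m → Bool) × (Fin m → α × α) | swapPairs y.1 y.2 ∈ A'} := by
    refine measurableSet_preimage (f := fun y : (Fin m → Bool) × (Fin m → α × α) =>
      swapPairs y.1 y.2) ?_ hA'm
    exact measurable_from_prod_countable_right fun σ => (measurePreserving_swapPairs μ σ).measurable
  have hstep3 : Q A' ≤ ENNReal.ofReal (N * Real.exp (-(m * τ ^ 2 / 2))) := by
    have h1 : (β.prod Q) {y | swapPairs y.1 y.2 ∈ A'} = Q A' := by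
      rw [Measure.prod_apply hAJ]
      have : ∀ σ : Fin m → Bool, Q (Prod.mk σ ⁻¹' {y | swapPairs y.1 y.2 ∈ A'}) = Q A' := fun σ =>
        (measurePreserving_swapPairs μ σ).measure_preimage hA'm.nullMeasurableSet
      rw [lintegral_congr this]
      simp
    rw [← h1, Measure.prod_apply_symm hAJ]
    calc _ ≤ ∫⁻ _, ENNReal.ofReal (N * Real.exp (-(m * τ ^ 2 / 2))) ∂Q := by
          refine lintegral_mono fun w => ?_
          obtain ⟨J, hJN, hJ⟩ := hcover w
          refine (ENNReal.le_ofReal_iff_toReal_le (measure_ne_top _ _) (by positivity)).2 ?_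
          refine le_trans (measureReal_mono ?_)
            (measure_swapPairs_le h01 hm hτ hgap w hJN hJ)
          rintro σ ⟨i, hi1, hi2⟩
          refine ⟨i, ?_⟩
          rw [div_le_iff₀ hm'] at hi1
          rw [lt_div_iff₀ hm'] at hi2
          rw [Finset.sum_sub_distrib]
          linarith
      _ = _ := by simp
  have hstep4 : Q.real A' ≤ N * Real.exp (-(m * τ ^ 2 / 2)) :=
    ENNReal.toReal_le_of_le_ofReal (by positivity) hstep3
  linarith

end Symmetrization

/-! ### Learning a regression function in `L¹` -/

section Selection

/-- Measurable selection from countably many alternatives. -/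
lemma exists_measurable_selection {Ω β : Type*} [MeasurableSpace Ω] [Countable β] [Nonempty β]
    (p : β → Ω → Prop) (hp : ∀ b, MeasurableSet {ω | p b ω}) :
    ∃ g : Ω → β, (∀ s : Set β, MeasurableSet (g ⁻¹' s)) ∧ ∀ ω, (∃ b, p b ω) → p (g ω) ω := by
  classical
  obtain ⟨u, hu⟩ := exists_surjective_nat β
  have hex : ∀ ω, ∃ n, p (u n) ω ∨ ¬ ∃ b, p b ω := by
    intro ω
    by_cases h : ∃ b, p b ω
    · obtain ⟨b, hb⟩ := h
      obtain ⟨n, rfl⟩ := hu b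
      exact ⟨n, Or.inl hb⟩
    · exact ⟨0, Or.inr h⟩
  have hE : MeasurableSet {ω | ∃ b, p b ω} := by
    rw [Set.ofPred_exists]
    exact MeasurableSet.iUnion hp
  have hmeas : Measurable fun ω => Nat.find (hex ω) := by
    refine measurable_find hex fun n => ?_
    rw [Set.ofPred_or]
    exact (hp (u n)).union hE.compl
  refine ⟨fun ω => u (Nat.find (hex ω)), fun s => hmeas (MeasurableSet.of_discrete (s := u ⁻¹' s)),
    fun ω h => ?_⟩
  exact (Nat.find_spec (hex ω)).resolve_right (not_not.2 h)

end Selection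

section Learning

variable {α Ω : Type*} [MeasurableSpace α] [MeasurableSpace Ω]

/-- The sign of `f j - f k`, with value `1` at ties. -/
noncomputable def signTest (f : ℕ → α → ℝ) (j k : ℕ) (x : α) : ℝ := if f k x ≤ f j x then 1 else -1

omit [MeasurableSpace α] in
lemma abs_signTest (f : ℕ → α → ℝ) (j k : ℕ) (x : α) : |signTest f j k x| = 1 := by
  unfold signTest
  split_ifs <;> simp

omit [MeasurableSpace α] in
lemma sub_mul_signTest (f : ℕ → α → ℝ) (j k : ℕ) (x : α) :
    (f j x - f k x) * signTest f j k x = |f j x - f k x| := by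
  unfold signTest
  split_ifs with h
  · rw [mul_one, abs_of_nonneg (by linarith)]
  · rw [abs_of_neg (by linarith)]
    ring

lemma measurable_signTest {f : ℕ → α → ℝ} (hf : ∀ i, Measurable (f i)) (j k : ℕ) :
    Measurable (signTest f j k) :=
  Measurable.ite (measurableSet_le (hf k) (hf j)) measurable_const measurable_const

/-- The residual of candidate `j`, tested against the sign of its difference with candidate `k`. -/
noncomputable def residualTest (X : Ω → α) (lab : Ω → ℝ) (f : ℕ → α → ℝ) (j k : ℕ) (ω : Ω) : ℝ :=
  (lab ω - f j (X ω)) * signTest f j k (X ω)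

lemma measurable_residualTest {X : Ω → α} (hX : Measurable X) {lab : Ω → ℝ} (hlab : Measurable lab)
    {f : ℕ → α → ℝ} (hf : ∀ i, Measurable (f i)) (j k : ℕ) :
    Measurable (residualTest X lab f j k) :=
  (hlab.sub ((hf j).comp hX)).mul ((measurable_signTest hf j k).comp hX)

omit [MeasurableSpace α] [MeasurableSpace Ω] in
lemma abs_residualTest_le {X : Ω → α} {lab : Ω → ℝ} (hlab : ∀ ω, lab ω ∈ Set.Icc (0 : ℝ) 1)
    {f : ℕ → α → ℝ} (hf : ∀ i x, f i x ∈ Set.Icc (0 : ℝ) 1) (j k : ℕ) (ω : Ω) :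
    |residualTest X lab f j k ω| ≤ 1 := by
  rw [residualTest, abs_mul, abs_signTest, mul_one, abs_le]
  have h1 := hlab ω
  have h2 := hf j (X ω)
  exact ⟨by linarith [h1.1, h2.2], by linarith [h1.2, h2.1]⟩

lemma integrable_of_abs_le {P : Measure Ω} [IsFiniteMeasure P] {g : Ω → ℝ} (hg : Measurable g)
    {K : ℝ} (h : ∀ ω, |g ω| ≤ K) : Integrable g P :=
  Integrable.of_bound hg.aestronglyMeasurable K (Filter.Eventually.of_forall h)

/-- The regression function `e` of the labels given the covariates, characterised by orthogonality
of the residual to every bounded function of the covariates. -/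
structure IsRegression (P : Measure Ω) (X : Ω → α) (lab : Ω → ℝ) (e : α → ℝ) : Prop where
  measurable : Measurable e
  mem_Icc : ∀ x, e x ∈ Set.Icc (0 : ℝ) 1
  integral_eq_zero : ∀ φ : α → ℝ, Measurable φ → (∀ x, |φ x| ≤ 1) →
    ∫ ω, (lab ω - e (X ω)) * φ (X ω) ∂P = 0

/-- **Selection by sign tests.** If all empirical residual tests among the candidates in `J` are
`t`-accurate and some candidate is `s`-close to the regression function `e` in `L¹`, then that
candidate passes all its tests at level `s + t`, and any passing candidate is `(3s + 2t)`-close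
to `e`. -/
lemma integral_abs_sub_le_of_tests {P : Measure Ω} [IsProbabilityMeasure P] {X : Ω → α}
    (hX : Measurable X) {lab : Ω → ℝ} (hlab : Measurable lab)
    (hlab01 : ∀ ω, lab ω ∈ Set.Icc (0 : ℝ) 1) {e : α → ℝ} (he : IsRegression P X lab e)
    {f : ℕ → α → ℝ} (hf : ∀ i, Measurable (f i)) (hf01 : ∀ i x, f i x ∈ Set.Icc (0 : ℝ) 1)
    {J : Finset ℕ} {M : ℕ → ℕ → ℝ} {s t : ℝ}
    (hM : ∀ j ∈ J, ∀ k ∈ J, |M j k - ∫ ω, residualTest X lab f j k ω ∂P| < t)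
    {b : ℕ} (hb : b ∈ J) (hbs : ∫ ω, |f b (X ω) - e (X ω)| ∂P ≤ s) :
    (∀ k ∈ J, |M b k| ≤ s + t) ∧ ∀ j ∈ J, (∀ k ∈ J, |M j k| ≤ s + t) →
      ∫ ω, |f j (X ω) - e (X ω)| ∂P ≤ 3 * s + 2 * t := by
  have hdiff : ∀ i x, |f i x - e x| ≤ 1 := fun i x => by
    have h1 := hf01 i x
    have h2 := he.mem_Icc x
    exact abs_le.2 ⟨by linarith [h1.1, h2.2], by linarith [h1.2, h2.1]⟩
  have hdiffm : ∀ i, Measurable fun ω => f i (X ω) - e (X ω) := fun i =>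
    ((hf i).comp hX).sub (he.measurable.comp hX)
  have hsm : ∀ j k, Measurable fun ω => signTest f j k (X ω) := fun j k =>
    (measurable_signTest hf j k).comp hX
  have hdiffI : ∀ i, Integrable (fun ω => |f i (X ω) - e (X ω)|) P := fun i =>
    integrable_of_abs_le (K := 1) (hdiffm i).abs fun ω => by rw [abs_abs]; exact hdiff i _
  have hprodI : ∀ i j k, Integrable (fun ω => (f i (X ω) - e (X ω)) * signTest f j k (X ω)) P :=
    fun i j k => integrable_of_abs_le (K := 1) ((hdiffm i).mul (hsm j k)) fun ω => by
      rw [abs_mul, abs_signTest, mul_one]; exact hdiff i _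
  have hprod : ∀ i j k, |∫ ω, (f i (X ω) - e (X ω)) * signTest f j k (X ω) ∂P|
      ≤ ∫ ω, |f i (X ω) - e (X ω)| ∂P := fun i j k => by
    refine (abs_integral_le_integral_abs).trans (le_of_eq (integral_congr_ae ?_))
    exact Filter.Eventually.of_forall fun ω => by
      simp only [abs_mul, abs_signTest, mul_one]
  -- the expected residual only sees the difference between the candidate and `e`
  have hres : ∀ j k, ∫ ω, residualTest X lab f j k ω ∂P
      = -∫ ω, (f j (X ω) - e (X ω)) * signTest f j k (X ω) ∂P := fun j k => by
    have h0 := he.integral_eq_zero (signTest f j k) (measurable_signTest hf j k)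
      fun x => (abs_signTest f j k x).le
    have hI : Integrable (fun ω => (lab ω - e (X ω)) * signTest f j k (X ω)) P :=
      integrable_of_abs_le (K := 1) ((hlab.sub (he.measurable.comp hX)).mul (hsm j k)) fun ω => by
        have h1 := hlab01 ω
        have h2 := he.mem_Icc (X ω)
        rw [abs_mul, abs_signTest, mul_one, abs_le]
        exact ⟨by linarith [h1.1, h2.2], by linarith [h1.2, h2.1]⟩
    have : ∀ ω, residualTest X lab f j k ω = (lab ω - e (X ω)) * signTest f j k (X ω)
        - (f j (X ω) - e (X ω)) * signTest f j k (X ω) := fun ω => by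
      rw [residualTest]; ring
    simp only [this]
    rw [integral_sub hI (hprodI j j k), h0, zero_sub]
  constructor
  · intro k hk
    have h1 := hM b hb k hk
    rw [hres] at h1
    have h2 := abs_le.1 ((hprod b b k).trans hbs)
    have h3 := abs_lt.1 h1
    exact abs_le.2 ⟨by linarith [h2.1, h3.1], by linarith [h2.2, h3.2]⟩
  · intro j hj hpass
    have h1 := abs_lt.1 (hM j hj b hb)
    rw [hres] at h1
    have h2 := abs_le.1 (hpass b hb)
    have h3 := abs_le.1 ((hprod b j b).trans hbs)
    have h4 : ∫ ω, |f j (X ω) - f b (X ω)| ∂P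
        = ∫ ω, (f j (X ω) - e (X ω)) * signTest f j b (X ω) ∂P
          - ∫ ω, (f b (X ω) - e (X ω)) * signTest f j b (X ω) ∂P := by
      rw [← integral_sub (hprodI j j b) (hprodI b j b)]
      refine integral_congr_ae (Filter.Eventually.of_forall fun ω => ?_)
      simp only [← sub_mul_signTest f j b (X ω)]
      ring
    have h5 : ∫ ω, |f j (X ω) - e (X ω)| ∂P
        ≤ ∫ ω, |f j (X ω) - f b (X ω)| ∂P + ∫ ω, |f b (X ω) - e (X ω)| ∂P := by
      have hI : Integrable (fun ω => |f j (X ω) - f b (X ω)|) P :=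
        integrable_of_abs_le (K := 1) (((hf j).comp hX).sub ((hf b).comp hX)).abs fun ω => by
          have h1 := hf01 j (X ω)
          have h2 := hf01 b (X ω)
          rw [abs_abs]
          exact abs_le.2 ⟨by linarith [h1.1, h2.2], by linarith [h1.2, h2.1]⟩
      rw [← integral_add hI (hdiffI b)]
      refine integral_mono (hdiffI j) (hI.add (hdiffI b)) fun ω => ?_
      exact abs_sub_le _ _ _
    linarith [h1.1, h1.2, h2.1, h2.2, h3.1, h3.2]

/-- **Learning in `L¹`.** From `2m` samples a measurable rule selects a member of a sequence of
functions of fat-shattering dimension `D` at scale `γ`. It is `212γ`-close in `L¹` to the regression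
function, up to the stated failure probability, whenever the sequence approximates the regression
function. The rule builds an empirical cover from the first `m` samples and selects from it by sign
tests on the other `m`.

The budget: an approximation of the regression function within `4γ`; an empirical cover at `16γ`,
which turns into `64γ` in `L¹`; hence a candidate within `s = 68γ`, and `212γ = 3s + 2t` after
selection with tests of accuracy `t = 4γ`. -/
theorem exists_learner {X : Ω → α} (hX : Measurable X) {lab : Ω → ℝ} (hlab : Measurable lab)
    (hlab01 : ∀ ω, lab ω ∈ Set.Icc (0 : ℝ) 1) {F : Set (α → ℝ)}
    (hF : ∀ f ∈ F, ∀ x, f x ∈ Set.Icc (0 : ℝ) 1) {γ : ℝ} (hγ : 0 < γ) {D : ℕ}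
    (hD : ∀ S, FatShatters F γ S → S.card ≤ D) {f : ℕ → α → ℝ} (hfF : ∀ i, f i ∈ F)
    (hf : ∀ i, Measurable (f i)) {x : ℝ} (hx : 0 < x) (hx1 : x ≤ 1) {p : ℕ} (hp : 1 / γ ≤ p)
    {m : ℕ} (hm : 0 < m) (hhalf : 2 * Real.exp (-(32 * m * γ ^ 2)) ≤ 1 / 2) :
    ∃ idx : (Fin (m + m) → Ω) → ℕ, Measurable idx ∧
      ∀ P : Measure Ω, IsProbabilityMeasure P → ∀ e : α → ℝ, IsRegression P X lab e →
        (∃ i, ∫ ω, |f i (X ω) - e (X ω)| ∂P ≤ 4 * γ) →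
        (Measure.pi fun _ : Fin (m + m) => P).real
            {T | 212 * γ < ∫ ω, |f (idx T) (X ω) - e (X ω)| ∂P}
          ≤ 2 * (coverBound D p (m + m) x * Real.exp (-(32 * m * γ ^ 2)))
            + coverBound D p m x ^ 2 * (2 * Real.exp (-(8 * m * γ ^ 2))) := by
  classical
  have hf01 : ∀ i x, f i x ∈ Set.Icc (0 : ℝ) 1 := fun i => hF _ (hfF i)
  have hfX : ∀ i, Measurable fun ω => f i (X ω) := fun i => (hf i).comp hX
  -- the empirical cover
  obtain ⟨cov, hcovm, hcov⟩ := exists_measurable_selection (Ω := Fin m → Ω) (β := Finset ℕ)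
    (fun J S => (J.card : ℝ) ≤ coverBound D p m x ∧
      ∀ i, ∃ j ∈ J, meanDist (f i) (f j) (fun l => X (S l)) ≤ 16 * γ) (by
      intro J
      rw [Set.ofPred_and]
      refine (MeasurableSet.const _).inter ?_
      simp only [Set.ofPred_forall, Set.ofPred_exists, Set.ofPred_and]
      refine MeasurableSet.iInter fun i => MeasurableSet.iUnion fun j =>
        (MeasurableSet.const _).inter (measurableSet_le ?_ measurable_const)
      have h1 := hfX i
      have h2 := hfX j
      unfold meanDist
      fun_prop)
  have hcov' : ∀ S, ((cov S).card : ℝ) ≤ coverBound D p m x ∧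
      ∀ i, ∃ j ∈ cov S, meanDist (f i) (f j) (fun l => X (S l)) ≤ 16 * γ := fun S =>
    hcov S (exists_cover hF hγ hD hfF (fun l => X (S l)) hx hx1 hp)
  -- a member of the cover that passes its tests
  set M : (Fin m → Ω) → ℕ → ℕ → ℝ := fun S j k => (∑ l, residualTest X lab f j k (S l)) / m with hM
  obtain ⟨sel, hselm, hsel⟩ := exists_measurable_selection (Ω := (Fin m → Ω) × (Fin m → Ω)) (β := ℕ)
    (fun j z => j ∈ cov z.1 ∧ ∀ k, k ∈ cov z.1 → |M z.2 j k| ≤ 72 * γ) (by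
      intro j
      have hin : ∀ k, MeasurableSet {z : (Fin m → Ω) × (Fin m → Ω) | k ∈ cov z.1} := fun k =>
        measurable_fst (hcovm {J | k ∈ J})
      simp only [Set.ofPred_and, Set.ofPred_forall]
      refine (hin j).inter (MeasurableSet.iInter fun k => ?_)
      have himp : {z : (Fin m → Ω) × (Fin m → Ω) | k ∈ cov z.1 → |M z.2 j k| ≤ 72 * γ}
          = {z | k ∈ cov z.1}ᶜ ∪ {z | |M z.2 j k| ≤ 72 * γ} := by
        ext z
        simp only [Set.mem_ofPred_eq, Set.mem_union, Set.mem_compl_iff, imp_iff_not_or]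
      rw [himp]
      refine (hin k).compl.union (measurableSet_le ?_ measurable_const)
      have h1 := measurable_residualTest hX hlab hf j k
      simp only [hM]
      fun_prop)
  have hselm' : Measurable sel := fun s _ => hselm s
  refine ⟨fun T => sel (fun l => T (Fin.castAdd m l), fun l => T (Fin.natAdd m l)),
    hselm'.comp (by fun_prop), ?_⟩
  intro P hP e he ⟨i₀, hi₀⟩
  set L : ℕ → ℝ := fun i => ∫ ω, |f i (X ω) - e (X ω)| ∂P with hL
  set A : Set ((Fin m → Ω) × (Fin m → Ω)) := {z | 212 * γ < L (sel z)} with hA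
  have hAm : MeasurableSet A :=
    measurableSet_lt measurable_const ((measurable_of_countable L).comp hselm')
  have happ := (measurePreserving_append P m m).measure_preimage (s := {T |
    212 * γ < L (sel (fun l => T (Fin.castAdd m l), fun l => T (Fin.natAdd m l)))})
    (measurableSet_lt measurable_const
      ((measurable_of_countable L).comp (hselm'.comp (by fun_prop)))).nullMeasurableSet
  have hpre : (fun z : (Fin m → Ω) × (Fin m → Ω) => Fin.append z.1 z.2) ⁻¹' {T |
      212 * γ < L (sel (fun l => T (Fin.castAdd m l), fun l => T (Fin.natAdd m l)))} = A := by
    ext z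
    simp only [Set.mem_preimage, Set.mem_ofPred_eq, Fin.append_left, Fin.append_right, hA]
  rw [hpre] at happ
  rw [measureReal_def, ← happ, ← measureReal_def]
  -- failure of the first stage: a candidate close to `f i₀` on the sample but not in `L¹`
  set h : ℕ → Ω → ℝ := fun i ω => |f i (X ω) - f i₀ (X ω)| with hh
  have hhm : ∀ i, Measurable (h i) := fun i => ((hfX i).sub (hfX i₀)).abs
  have hh01 : ∀ i ω, h i ω ∈ Set.Icc (0 : ℝ) 1 := fun i ω => by
    have h1 := hf01 i (X ω)
    have h2 := hf01 i₀ (X ω)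
    exact ⟨abs_nonneg _, abs_le.2 ⟨by linarith [h1.1, h2.2], by linarith [h1.2, h2.1]⟩⟩
  have hstage1 := measure_exists_mean_le_lt_integral_le P hhm hh01 hm (r := 16 * γ) (s := 64 * γ)
    (v := 8 * γ) (t := 16 * γ) (τ := 8 * γ) (N := coverBound D p (m + m) x) (by positivity)
    (by positivity) (by unfold coverBound; positivity) (by linarith)
    (by
      have : (m : ℝ) * (8 * γ) ^ 2 / 2 = 32 * m * γ ^ 2 := by ring
      rw [this]
      exact hhalf)
    (by
      intro w
      obtain ⟨J, hJN, hJ⟩ := exists_cover hF hγ hD hfF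
        (Fin.append (fun l => X (w l).1) fun l => X (w l).2) hx hx1 hp
      refine ⟨J, hJN, fun i => ?_⟩
      obtain ⟨j, hj, hij⟩ := hJ i
      refine ⟨j, hj, ?_⟩
      rw [meanDist, div_le_iff₀ (by push_cast; positivity), Fin.sum_univ_add] at hij
      simp only [Fin.append_left, Fin.append_right, Nat.cast_add] at hij
      rw [← Finset.sum_add_distrib] at hij
      have hle : ∀ ω, |h i ω - h j ω| ≤ |f i (X ω) - f j (X ω)| := fun ω => by
        refine (abs_abs_sub_abs_le _ _).trans (le_of_eq ?_)
        congr 1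
        ring
      calc _ ≤ ∑ l, (|f i (X (w l).1) - f j (X (w l).1)| + |f i (X (w l).2) - f j (X (w l).2)|) :=
            Finset.sum_le_sum fun l _ => add_le_add (hle _) (hle _)
        _ ≤ _ := by linarith)
  have hexp1 : (m : ℝ) * (8 * γ) ^ 2 / 2 = 32 * m * γ ^ 2 := by ring
  rw [hexp1] at hstage1
  refine prod_real_le_add _ _ hAm (by unfold coverBound; positivity) hstage1 ?_
  intro S hS
  obtain ⟨hcard, hcover⟩ := hcov' S
  obtain ⟨b, hb, hbd⟩ := hcover i₀
  have hbs : ∫ ω, |f b (X ω) - e (X ω)| ∂P ≤ 68 * γ := by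
    have h1 : ∫ ω, h b ω ∂P ≤ 64 * γ := by
      by_contra hcon
      refine hS ⟨b, ?_, not_le.1 hcon⟩
      refine le_trans (le_of_eq ?_) hbd
      simp only [hh, meanDist, abs_sub_comm]
    have hI : ∀ i, Integrable (fun ω => |f i (X ω) - e (X ω)|) P := fun i =>
      integrable_of_abs_le (K := 1) ((hfX i).sub (he.measurable.comp hX)).abs fun ω => by
        have h1 := hf01 i (X ω)
        have h2 := he.mem_Icc (X ω)
        rw [abs_abs]
        exact abs_le.2 ⟨by linarith [h1.1, h2.2], by linarith [h1.2, h2.1]⟩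
    have hI' : Integrable (h b) P := integrable_of_abs_le (K := 1) (hhm b) fun ω => by
      rw [abs_of_nonneg (hh01 b ω).1]; exact (hh01 b ω).2
    have h2 : ∫ ω, |f b (X ω) - e (X ω)| ∂P ≤ ∫ ω, h b ω ∂P + ∫ ω, |f i₀ (X ω) - e (X ω)| ∂P := by
      rw [← integral_add hI' (hI i₀)]
      exact integral_mono (hI b) (hI'.add (hI i₀)) fun ω => abs_sub_le _ _ _
    linarith
  -- failure of the second stage: some test among the candidates is inaccurate
  have hsub : {S' | (S, S') ∈ A} ⊆ ⋃ j ∈ cov S, ⋃ k ∈ cov S,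
      {S' | 4 * γ ≤ |(∑ l, residualTest X lab f j k (S' l)) / m
        - ∫ ω, residualTest X lab f j k ω ∂P|} := by
    intro S' hS'
    by_contra hcon
    simp only [Set.mem_iUnion, not_exists, Set.mem_ofPred_eq, not_le] at hcon
    have htests := integral_abs_sub_le_of_tests hX hlab hlab01 he hf hf01 (M := M S')
      (fun j hj k hk => hcon j hj k hk) hb hbs
    have hpass := hsel (S, S') ⟨b, hb, fun k hk => (htests.1 k hk).trans (by linarith)⟩
    have := htests.2 _ hpass.1 fun k hk => (hpass.2 k hk).trans (by linarith)
    have hlt : 212 * γ < L (sel (S, S')) := hS'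
    simp only [hL] at hlt
    linarith
  have hone : ∀ j k, (Measure.pi fun _ : Fin m => P).real
      {S' | 4 * γ ≤ |(∑ l, residualTest X lab f j k (S' l)) / m
        - ∫ ω, residualTest X lab f j k ω ∂P|} ≤ 2 * Real.exp (-(8 * m * γ ^ 2)) := by
    intro j k
    refine (measure_abs_mean_sub_integral_ge_le P (measurable_residualTest hX hlab hf j k) (K := 1)
      (Filter.Eventually.of_forall fun ω => ?_) hm (by positivity)).trans (le_of_eq ?_)
    · exact abs_le.1 (abs_residualTest_le hlab01 hf01 j k ω)
    · congr 3
      ring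
  calc _ ≤ _ := measureReal_mono hsub (measure_ne_top _ _)
    _ ≤ _ := measureReal_biUnion_finset_le _ _
    _ ≤ ∑ j ∈ cov S, ∑ k ∈ cov S, 2 * Real.exp (-(8 * m * γ ^ 2)) :=
        Finset.sum_le_sum fun j _ => (measureReal_biUnion_finset_le _ _).trans
          (Finset.sum_le_sum fun k _ => hone j k)
    _ = ((cov S).card : ℝ) ^ 2 * (2 * Real.exp (-(8 * m * γ ^ 2))) := by
        simp only [Finset.sum_const, nsmul_eq_mul]
        ring
    _ ≤ _ := by gcongr

end Learning

/-! ### A countable `L¹`-dense subfamily -/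

section Dense

open Filter Topology in
/-- Every class of bounded measurable functions contains a sequence that is dense in `L¹(μ)`
simultaneously for all probability measures `μ` dominated by a fixed `σ`-finite measure: a sequence
dense in `L¹` of an equivalent finite measure has subsequences converging almost everywhere. -/
lemma exists_seq_dense {α : Type*} [MeasurableSpace α] [MeasurableSpace.CountablyGenerated α]
    (ν : Measure α) [SFinite ν] {F : Set (α → ℝ)} (hne : F.Nonempty)
    (hFm : ∀ f ∈ F, Measurable f) (hF : ∀ f ∈ F, ∀ x, f x ∈ Set.Icc (0 : ℝ) 1) :
    ∃ f : ℕ → α → ℝ, (∀ i, f i ∈ F) ∧ ∀ e ∈ F, ∀ μ : Measure α, IsProbabilityMeasure μ → μ ≪ ν →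
      ∀ r : ℝ, 0 < r → ∃ i, ∫ x, |f i x - e x| ∂μ ≤ r := by
  set ν' := ν.toFinite with hν'
  have hI : ∀ f ∈ F, Integrable f ν' := fun f hf =>
    integrable_of_abs_le (K := 1) (hFm f hf) fun x => by
      rw [abs_of_nonneg (hF f hf x).1]; exact (hF f hf x).2
  let Φ : F → Lp ℝ 1 ν' := fun f => (hI f.1 f.2).toL1 f.1
  have : Fact ((1 : ENNReal) ≠ ⊤) := ⟨ENNReal.one_ne_top⟩
  have : Nonempty F := hne.to_subtype
  have : Nonempty (Set.range Φ) := (Set.range_nonempty Φ).to_subtype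
  obtain ⟨u, hu⟩ := TopologicalSpace.exists_dense_seq (Set.range Φ)
  choose g hg using fun i => (u i).2
  refine ⟨fun i => (g i).1, fun i => (g i).2, fun e he μ hμ hμν r hr => ?_⟩
  have hclose : ∀ n : ℕ, ∃ i, dist (Φ (g i)) (Φ ⟨e, he⟩) < 1 / ((n : ℝ) + 1) := fun n => by
    obtain ⟨i, hi⟩ := hu.exists_dist_lt ⟨Φ ⟨e, he⟩, Set.mem_range_self _⟩
      (ε := 1 / ((n : ℝ) + 1)) (by positivity)
    refine ⟨i, ?_⟩
    rw [hg i, dist_comm]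
    exact hi
  choose i hi using hclose
  have htend : Tendsto (fun n => Φ (g (i n))) atTop (𝓝 (Φ ⟨e, he⟩)) := by
    rw [tendsto_iff_dist_tendsto_zero]
    exact squeeze_zero (fun _ => dist_nonneg) (fun n => (hi n).le)
      tendsto_one_div_add_atTop_nhds_zero_nat
  obtain ⟨ns, -, hns⟩ := (tendstoInMeasure_of_tendsto_Lp htend).exists_seq_tendsto_ae
  have hae : ∀ᵐ x ∂ν', Tendsto (fun k => (g (i (ns k))).1 x) atTop (𝓝 (e x)) := by
    have h1 : ∀ᵐ x ∂ν', ∀ k, Φ (g (i (ns k))) x = (g (i (ns k))).1 x :=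
      ae_all_iff.2 fun k => (hI _ (g (i (ns k))).2).coeFn_toL1
    have h2 : ∀ᵐ x ∂ν', Φ ⟨e, he⟩ x = e x := (hI e he).coeFn_toL1
    filter_upwards [hns, h1, h2] with x hx h1x h2x
    rw [h2x] at hx
    simpa only [h1x] using hx
  have hae' : ∀ᵐ x ∂μ, Tendsto (fun k => (g (i (ns k))).1 x) atTop (𝓝 (e x)) :=
    (hμν.trans (absolutelyContinuous_toFinite ν)).ae_le hae
  have hint : Tendsto (fun k => ∫ x, |(g (i (ns k))).1 x - e x| ∂μ) atTop (𝓝 (∫ _, (0 : ℝ) ∂μ)) := by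
    refine tendsto_integral_of_dominated_convergence (fun _ => 1) (fun k => ?_)
      (integrable_const _) (fun k => ?_) ?_
    · exact ((hFm _ (g (i (ns k))).2).sub (hFm e he)).abs.aestronglyMeasurable
    · refine Eventually.of_forall fun x => ?_
      have h1 := hF _ (g (i (ns k))).2 x
      have h2 := hF e he x
      rw [Real.norm_eq_abs, abs_abs]
      exact abs_le.2 ⟨by linarith [h1.1, h2.2], by linarith [h1.2, h2.1]⟩
    · filter_upwards [hae'] with x hx
      have := (hx.sub_const (e x)).abs
      simpa using this
  rw [integral_zero] at hint
  obtain ⟨k, hk⟩ := (hint.eventually (gt_mem_nhds hr)).exists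
  exact ⟨_, hk.le⟩

end Dense

/-! ### Identification of the average treatment effect -/

section Identification

variable {d : ℕ}

lemma measurable_potentialOutcome (t : Bool) :
    Measurable (potentialOutcome t : Record d → ℝ) := by
  unfold potentialOutcome
  cases t
  · simp only [Bool.false_eq_true, if_false]; fun_prop
  · simp only [if_true]; fun_prop

lemma measurable_covOutcome (t : Bool) : Measurable (covOutcome t : Record d → Cov d × ℝ) :=
  measurable_fst.prodMk (measurable_potentialOutcome t)

lemma measurableSet_arm (t : Bool) : MeasurableSet {u : Record d | u.2.1 = t} :=
  (measurable_fst.comp measurable_snd) (MeasurableSet.singleton t)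

lemma measurable_censor : Measurable (censor : Record d → Sample d) := by
  refine measurable_fst.prodMk ((measurable_fst.comp measurable_snd).prodMk ?_)
  unfold potentialOutcome
  exact Measurable.ite (measurableSet_arm true) (by fun_prop) (by fun_prop)

/-- The treatment indicator as a real label. -/
def label (s : Sample d) : ℝ := if s.2.1 then 1 else 0

lemma measurable_label : Measurable (label : Sample d → ℝ) :=
  Measurable.ite ((measurable_fst.comp measurable_snd) (MeasurableSet.singleton true))
    measurable_const measurable_const

lemma label_mem_Icc (s : Sample d) : label s ∈ Set.Icc (0 : ℝ) 1 := by
  unfold label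
  split_ifs <;> simp

lemma measurable_ipwTerm {e : Cov d → ℝ} (he : Measurable e) : Measurable (ipwTerm e) := by
  have h1 : Measurable fun s : Sample d => (if s.2.1 then (1 : ℝ) else 0) := measurable_label
  unfold ipwTerm
  fun_prop

/-- Weighting by the treatment indicator is, in the mean, weighting by the propensity score. -/
lemma integral_indicator_eq_integral_mul {D : Measure (Record d)} [IsProbabilityMeasure D]
    {t : Bool} {p : Cov d × ℝ → ℝ} (hp : IsGenPropensity D t p) {h : Cov d × ℝ → ℝ}
    (hh : Measurable h) {K : ℝ} (hK : ∀ᵐ u ∂D, |h (covOutcome t u)| ≤ K) :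
    ∫ u, h (covOutcome t u) * (if u.2.1 = t then 1 else 0) ∂D
      = ∫ u, h (covOutcome t u) * p (covOutcome t u) ∂D := by
  have hm := (measurable_covOutcome (d := d) t).comap_le
  have hind : ∀ u : Record d, ({u : Record d | u.2.1 = t}.indicator (fun _ => (1 : ℝ))) u
      = if u.2.1 = t then 1 else 0 := fun u => by
    simp [Set.indicator_apply]
  have hf : StronglyMeasurable[MeasurableSpace.comap (covOutcome t) inferInstance]
      fun u => h (covOutcome t u) :=
    (hh.comp (comap_measurable (covOutcome t))).stronglyMeasurable
  have hg : Integrable ({u : Record d | u.2.1 = t}.indicator fun _ => (1 : ℝ)) D :=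
    (integrable_const _).indicator (measurableSet_arm t)
  have hfg : Integrable ((fun u => h (covOutcome t u))
      * {u : Record d | u.2.1 = t}.indicator fun _ => (1 : ℝ)) D :=
    hg.bdd_mul (hh.comp (measurable_covOutcome t)).aestronglyMeasurable hK
  have hpull := condExp_mul_of_stronglyMeasurable_left hf hfg hg
  calc ∫ u, h (covOutcome t u) * (if u.2.1 = t then 1 else 0) ∂D
      = ∫ u, ((fun u => h (covOutcome t u))
          * {u : Record d | u.2.1 = t}.indicator fun _ => (1 : ℝ)) u ∂D := by
        simp only [Pi.mul_apply, hind]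
    _ = ∫ u, (D[(fun u => h (covOutcome t u)) * {u : Record d | u.2.1 = t}.indicator
          fun _ => (1 : ℝ) | MeasurableSpace.comap (covOutcome t) inferInstance]) u ∂D :=
        (integral_condExp hm).symm
    _ = _ := by
        refine integral_congr_ae ?_
        filter_upwards [hpull, hp.2] with u h1 h2
        rw [h1, Pi.mul_apply, h2]

variable {c : ℝ} {D : Measure (Record d)} [IsProbabilityMeasure D] {p₀ p₁ : Cov d × ℝ → ℝ}

/-- Weighting by the treatment indicator, for functions of the covariates under
unconfoundedness. -/
lemma integral_cov_indicator {t : Bool} {p : Cov d × ℝ → ℝ} (hp : IsGenPropensity D t p)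
    (hc : p ∈ overlapUnconf d c) {φ : Cov d → ℝ} (hφ : Measurable φ) {K : ℝ}
    (hK : ∀ x, |φ x| ≤ K) :
    ∫ u, φ u.1 * (if u.2.1 = t then 1 else 0) ∂D = ∫ u, φ u.1 * p (u.1, 0) ∂D := by
  have h := integral_indicator_eq_integral_mul hp (h := fun w => φ w.1) (hφ.comp measurable_fst)
    (Filter.Eventually.of_forall fun u => hK _)
  have e : ∀ u : Record d, p (covOutcome t u) = p (u.1, 0) := fun u => (hc.2 u.1 _ 0).1
  simp only [e] at h
  exact h

lemma measurable_slice {p : Cov d × ℝ → ℝ} (hp : Measurable p) :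
    Measurable fun x : Cov d => p (x, 0) := hp.comp (by fun_prop)

/-- Under unconfoundedness the propensity score is the regression function of the treatment
indicator on the covariates. -/
lemma isRegression_propensity (h₁ : IsGenPropensity D true p₁) (hc₁ : p₁ ∈ overlapUnconf d c) :
    IsRegression (censoredLaw D) Prod.fst label fun x => p₁ (x, 0) where
  measurable := measurable_slice h₁.1
  mem_Icc x := hc₁.1 _
  integral_eq_zero φ hφ hφ1 := by
    have hm := measurable_slice h₁.1
    have hmeas : Measurable fun s : Sample d => (label s - p₁ (s.1, 0)) * φ s.1 :=
      (measurable_label.sub (hm.comp measurable_fst)).mul (hφ.comp measurable_fst)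
    rw [censoredLaw, integral_map measurable_censor.aemeasurable hmeas.aestronglyMeasurable]
    have e : ∀ u : Record d, (label (censor u) - p₁ ((censor u).1, 0)) * φ (censor u).1
        = φ u.1 * (if u.2.1 = true then 1 else 0) - φ u.1 * p₁ (u.1, 0) := fun u => by
      obtain ⟨x, t, y⟩ := u
      cases t <;> simp [label, censor] <;> ring
    simp only [e]
    rw [integral_sub, integral_cov_indicator h₁ hc₁ hφ hφ1, sub_self]
    · refine integrable_of_abs_le (K := 1) ((hφ.comp measurable_fst).mul
        (Measurable.ite (measurableSet_arm true) measurable_const measurable_const)) fun u => ?_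
      rw [abs_mul]
      refine mul_le_one₀ (hφ1 _) (abs_nonneg _) ?_
      split_ifs <;> simp
    · refine integrable_of_abs_le (K := 1) ((hφ.comp measurable_fst).mul
        (hm.comp measurable_fst)) fun u => ?_
      rw [abs_mul]
      refine mul_le_one₀ (hφ1 _) (abs_nonneg _) ?_
      rw [abs_of_nonneg (hc₁.1 _).1]
      exact (hc₁.1 _).2

/-- The propensity scores of the two arms add up to one almost surely. -/
lemma propensity_add_eq_one (h₀ : IsGenPropensity D false p₀) (h₁ : IsGenPropensity D true p₁)
    (hc₀ : p₀ ∈ overlapUnconf d c) (hc₁ : p₁ ∈ overlapUnconf d c) :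
    ∀ᵐ u ∂D, p₀ (u.1, 0) + p₁ (u.1, 0) = 1 := by
  have hm₀ := measurable_slice h₀.1
  have hm₁ := measurable_slice h₁.1
  -- test against the sign of the defect
  set φ : Cov d → ℝ := fun x => if 0 ≤ p₀ (x, 0) + p₁ (x, 0) - 1 then 1 else -1 with hφ
  have hφm : Measurable φ := Measurable.ite
    (measurableSet_le measurable_const ((hm₀.add hm₁).sub measurable_const))
    measurable_const measurable_const
  have hφ1 : ∀ x, |φ x| ≤ 1 := fun x => by
    simp only [hφ]
    split_ifs <;> simp
  have hI : ∀ (t : Bool), Integrable (fun u : Record d => φ u.1 * (if u.2.1 = t then 1 else 0)) D :=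
    fun t => integrable_of_abs_le (K := 1) ((hφm.comp measurable_fst).mul
      (Measurable.ite (measurableSet_arm t) measurable_const measurable_const)) fun u => by
        rw [abs_mul]
        refine mul_le_one₀ (hφ1 _) (abs_nonneg _) ?_
        split_ifs <;> simp
  have hI' : ∀ p : Cov d × ℝ → ℝ, Measurable p → p ∈ overlapUnconf d c →
      Integrable (fun u : Record d => φ u.1 * p (u.1, 0)) D := fun p hp hc =>
    integrable_of_abs_le (K := 1) ((hφm.comp measurable_fst).mul
      ((measurable_slice hp).comp measurable_fst)) fun u => by
        rw [abs_mul]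
        refine mul_le_one₀ (hφ1 _) (abs_nonneg _) ?_
        rw [abs_of_nonneg (hc.1 _).1]
        exact (hc.1 _).2
  have hIφ : Integrable (fun u : Record d => φ u.1) D :=
    integrable_of_abs_le (K := 1) (hφm.comp measurable_fst) fun u => hφ1 _
  have key : ∫ u : Record d, |p₀ (u.1, 0) + p₁ (u.1, 0) - 1| ∂D = 0 := by
    have e : ∀ u : Record d, |p₀ (u.1, 0) + p₁ (u.1, 0) - 1|
        = φ u.1 * p₀ (u.1, 0) + φ u.1 * p₁ (u.1, 0) - φ u.1 := fun u => by
      simp only [hφ]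
      split_ifs with h
      · rw [abs_of_nonneg h]; ring
      · rw [abs_of_neg (not_le.1 h)]; ring
    simp only [e]
    have hIs : Integrable (fun u : Record d => φ u.1 * p₀ (u.1, 0) + φ u.1 * p₁ (u.1, 0)) D :=
      (hI' _ h₀.1 hc₀).add (hI' _ h₁.1 hc₁)
    rw [integral_sub hIs hIφ, integral_add (hI' _ h₀.1 hc₀) (hI' _ h₁.1 hc₁), ← integral_cov_indicator h₀ hc₀ hφm hφ1,
      ← integral_cov_indicator h₁ hc₁ hφm hφ1, ← integral_add (hI false) (hI true), sub_eq_zero]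
    refine integral_congr_ae (Filter.Eventually.of_forall fun u => ?_)
    simp only
    cases u.2.1 <;> simp
  rw [integral_eq_zero_iff_of_nonneg (fun _ => abs_nonneg _)] at key
  · filter_upwards [key] with u hu
    simp only [Pi.zero_apply, abs_eq_zero] at hu
    linarith
  · refine integrable_of_abs_le (K := 1) (((hm₀.comp measurable_fst).add
      (hm₁.comp measurable_fst)).sub measurable_const).abs fun u => ?_
    have a0 := hc₀.1 (u.1, 0)
    have a1 := hc₁.1 (u.1, 0)
    rw [abs_abs]
    exact abs_le.2 ⟨by linarith [a0.1, a1.1], by linarith [a0.2, a1.2]⟩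

variable {B : ℝ}

/-- One arm of the bias: dividing by an approximate instead of the true propensity score costs at
most `B/c` times their `L¹` distance. -/
lemma abs_integral_arm_sub_le {t : Bool} {p : Cov d × ℝ → ℝ} (hp : IsGenPropensity D t p)
    (hc : p ∈ overlapUnconf d c) (hc0 : 0 < c) (hB : 0 ≤ B)
    (hY : ∀ᵐ u ∂D, potentialOutcome t u ∈ Set.Icc (-B) B) {w : Cov d → ℝ} (hw : Measurable w)
    (hwc : ∀ x, c < w x) (hw1 : ∀ x, w x ≤ 1) :
    |∫ u, potentialOutcome t u / w u.1 * (if u.2.1 = t then 1 else 0) ∂D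
        - ∫ u, potentialOutcome t u ∂D| ≤ B / c * ∫ u, |w u.1 - p (u.1, 0)| ∂D := by
  have hpm := measurable_slice hp.1
  have hYabs : ∀ᵐ u ∂D, |potentialOutcome t u| ≤ B := by
    filter_upwards [hY] with u hu using abs_le.2 hu
  have hYw : ∀ᵐ u ∂D, |potentialOutcome t u / w u.1| ≤ B / c := by
    filter_upwards [hYabs] with u hu
    rw [abs_div, abs_of_pos (hc0.trans (hwc _))]
    exact div_le_div₀ hB hu hc0 (hwc _).le
  have h1 := integral_indicator_eq_integral_mul hp (h := fun z => z.2 / w z.1)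
    (measurable_snd.div (hw.comp measurable_fst)) hYw
  have e : ∀ u : Record d, p (covOutcome t u) = p (u.1, 0) := fun u => (hc.2 u.1 _ 0).1
  simp only [e] at h1
  simp only [covOutcome] at h1
  have hYm := measurable_potentialOutcome (d := d) t
  have hwm : Measurable fun u : Record d => w u.1 := hw.comp measurable_fst
  have hpm' : Measurable fun u : Record d => p (u.1, 0) := hpm.comp measurable_fst
  have hI1 : Integrable (fun u : Record d => potentialOutcome t u / w u.1 * p (u.1, 0)) D := by
    refine Integrable.of_bound ((hYm.div hwm).mul hpm').aestronglyMeasurable (B / c) ?_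
    filter_upwards [hYw] with u hu
    rw [Real.norm_eq_abs, abs_mul, abs_of_nonneg (hc.1 _).1]
    exact (mul_le_of_le_one_right (abs_nonneg _) (hc.1 _).2).trans hu
  have hI2 : Integrable (fun u : Record d => potentialOutcome t u) D :=
    Integrable.of_bound hYm.aestronglyMeasurable B hYabs
  have hI3 : Integrable (fun u : Record d => |w u.1 - p (u.1, 0)|) D := by
    refine integrable_of_abs_le (K := 1) (hwm.sub hpm').abs fun u => ?_
    have a0 := hc.1 (u.1, 0)
    have a1 := hwc u.1
    have a2 := hw1 u.1
    rw [abs_abs]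
    exact abs_le.2 ⟨by linarith [a0.2], by linarith [a0.1]⟩
  rw [h1, ← integral_sub hI1 hI2, ← integral_const_mul]
  refine abs_integral_le_integral_abs.trans (integral_mono_ae (hI1.sub hI2).abs
    (hI3.const_mul _) ?_)
  filter_upwards [hYw] with u hu
  have hwpos := hc0.trans (hwc u.1)
  have : potentialOutcome t u / w u.1 * p (u.1, 0) - potentialOutcome t u
      = -(potentialOutcome t u / w u.1 * (w u.1 - p (u.1, 0))) := by
    field_simp
    ring
  simp only [this, abs_neg, abs_mul]
  exact mul_le_mul_of_nonneg_right hu (abs_nonneg _)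

lemma ipwTerm_censor (e : Cov d → ℝ) (u : Record d) :
    ipwTerm e (censor u) = potentialOutcome true u / e u.1 * (if u.2.1 = true then 1 else 0)
      - potentialOutcome false u / (1 - e u.1) * (if u.2.1 = false then 1 else 0) := by
  obtain ⟨x, t, y⟩ := u
  cases t <;> simp [ipwTerm, censor, potentialOutcome]

omit [IsProbabilityMeasure D] in
/-- The summands of the weighted estimator are bounded by `B/c`. -/
lemma ae_ipwTerm_mem_Icc (hc0 : 0 < c) (hB : 0 ≤ B)
    (hY : ∀ t, ∀ᵐ u ∂D, potentialOutcome t u ∈ Set.Icc (-B) B) {e : Cov d → ℝ} (he : Measurable e)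
    (hec : ∀ x, c < e x ∧ e x < 1 - c) :
    ∀ᵐ s ∂censoredLaw D, ipwTerm e s ∈ Set.Icc (-(B / c)) (B / c) := by
  rw [censoredLaw, ae_map_iff measurable_censor.aemeasurable
    ((measurable_ipwTerm he) measurableSet_Icc)]
  filter_upwards [hY true, hY false] with u h1 h0
  refine abs_le.1 ?_
  have hec' := hec u.1
  rw [ipwTerm_censor]
  cases u.2.1
  · simp only [Bool.false_eq_true, if_false, if_true, mul_zero, mul_one, zero_sub, abs_neg]
    rw [abs_div, abs_of_pos (by linarith : 0 < 1 - e u.1)]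
    exact div_le_div₀ hB (abs_le.2 h0) hc0 (by linarith)
  · simp only [Bool.true_eq_false, if_false, if_true, mul_zero, mul_one, sub_zero]
    rw [abs_div, abs_of_pos (by linarith : 0 < e u.1)]
    exact div_le_div₀ hB (abs_le.2 h1) hc0 (by linarith)

/-- **Bias of inverse propensity weighting** with an approximate propensity score `e`. -/
lemma abs_integral_ipwTerm_sub_ate_le (h₀ : IsGenPropensity D false p₀)
    (h₁ : IsGenPropensity D true p₁) (hc₀ : p₀ ∈ overlapUnconf d c) (hc₁ : p₁ ∈ overlapUnconf d c)
    (hc0 : 0 < c) (hB : 0 ≤ B) (hY : ∀ t, ∀ᵐ u ∂D, potentialOutcome t u ∈ Set.Icc (-B) B)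
    {e : Cov d → ℝ} (he : Measurable e) (hec : ∀ x, c < e x ∧ e x < 1 - c) :
    |∫ s, ipwTerm e s ∂censoredLaw D - ate D|
      ≤ 2 * (B / c) * ∫ s, |e s.1 - p₁ (s.1, 0)| ∂censoredLaw D := by
  have hm₁ := measurable_slice h₁.1
  have hdm : Measurable fun s : Sample d => |e s.1 - p₁ (s.1, 0)| :=
    ((he.comp measurable_fst).sub (hm₁.comp measurable_fst)).abs
  have a1 := abs_integral_arm_sub_le h₁ hc₁ hc0 hB (hY true) he (fun x => (hec x).1)
    fun x => by linarith [(hec x).2]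
  have a0 := abs_integral_arm_sub_le h₀ hc₀ hc0 hB (hY false) (w := fun x => 1 - e x)
    (measurable_const.sub he) (fun x => by linarith [(hec x).2]) fun x => by linarith [(hec x).1]
  have e0 : ∫ u, |1 - e u.1 - p₀ (u.1, 0)| ∂D = ∫ u, |e u.1 - p₁ (u.1, 0)| ∂D := by
    refine integral_congr_ae ?_
    filter_upwards [propensity_add_eq_one h₀ h₁ hc₀ hc₁] with u hu
    rw [← abs_neg]
    congr 1
    linarith
  rw [e0] at a0
  have hYI : ∀ t, Integrable (fun u : Record d => potentialOutcome t u) D := fun t => by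
    refine Integrable.of_bound (measurable_potentialOutcome t).aestronglyMeasurable B ?_
    filter_upwards [hY t] with u hu using abs_le.2 hu
  have hI : ∀ (t : Bool) (w : Cov d → ℝ), Measurable w → (∀ x, c < w x) → Integrable
      (fun u : Record d => potentialOutcome t u / w u.1 * (if u.2.1 = t then 1 else 0)) D := by
    intro t w hw hwc
    refine Integrable.of_bound (((measurable_potentialOutcome t).div (hw.comp measurable_fst)).mul
      (Measurable.ite (measurableSet_arm t) measurable_const
        measurable_const)).aestronglyMeasurable (B / c) ?_
    filter_upwards [hY t] with u hu
    rw [Real.norm_eq_abs, abs_mul, abs_div, abs_of_pos (hc0.trans (hwc _))]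
    refine (mul_le_of_le_one_right (by positivity [hc0.trans (hwc u.1)]) ?_).trans
      (div_le_div₀ hB (abs_le.2 hu) hc0 (hwc _).le)
    split_ifs <;> simp
  rw [censoredLaw, integral_map measurable_censor.aemeasurable
      (measurable_ipwTerm he).aestronglyMeasurable,
    integral_map measurable_censor.aemeasurable hdm.aestronglyMeasurable]
  simp only [ipwTerm_censor]
  rw [integral_sub (hI true e he fun x => (hec x).1)
    (hI false (fun x => 1 - e x) (measurable_const.sub he) fun x => by linarith [(hec x).2]), ate,
    integral_sub (hYI true) (hYI false)]
  have b1 := abs_le.1 a1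
  have b0 := abs_le.1 a0
  simp only [censor]
  refine abs_le.2 ⟨by linarith [b1.1, b0.2], by linarith [b1.2, b0.1]⟩

end Identification

/-! ### Sample size and the weighted estimator -/

section Estimator

variable {d : ℕ}

lemma ipwEstimator_append {k l : ℕ} (hk : k ≤ k + l)
    (learn : (Fin k → Sample d) → Cov d → ℝ) (a : Fin k → Sample d) (b : Fin l → Sample d) :
    ipwEstimator hk learn (Fin.append a b) = (∑ i, ipwTerm (learn a) (b i)) / l := by
  have h1 : (fun j => (Fin.append a b : Fin (k + l) → Sample d) (Fin.castLE hk j)) = a :=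
    funext fun j => Fin.append_left a b j
  unfold ipwEstimator
  simp only [h1]
  rw [Finset.sum_filter, Fin.sum_univ_add]
  have h2 : ∀ i : Fin k, ¬ k ≤ (Fin.castAdd l i : Fin (k + l)).val := fun i => by
    simp
  have h3 : ∀ i : Fin l, k ≤ (Fin.natAdd k i : Fin (k + l)).val := fun i => by
    simp
  simp only [h2, h3, if_false, if_true, Finset.sum_const_zero, zero_add, Fin.append_right]
  push_cast
  rw [add_sub_cancel_left]
  ring

/-- The average treatment effect of outcomes in `[-B, B]` is at most `2B`. -/
lemma abs_ate_le {D : Measure (Record d)} [IsProbabilityMeasure D] {B : ℝ}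
    (hY : ∀ t, ∀ᵐ u ∂D, potentialOutcome t u ∈ Set.Icc (-B) B) : |ate D| ≤ 2 * B := by
  have h := norm_integral_le_of_norm_le_const (μ := D) (C := 2 * B)
    (f := fun u => potentialOutcome true u - potentialOutcome false u) (by
      filter_upwards [hY true, hY false] with u h1 h0
      rw [Real.norm_eq_abs]
      exact abs_le.2 ⟨by linarith [h1.1, h0.2], by linarith [h1.2, h0.1]⟩)
  simpa [ate] using h

/-- The outcome bound, transferred from the class `Q` to a realizable study. -/
lemma Realizable.ae_potentialOutcome {P : Set (Cov d × ℝ → ℝ)}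
    {Q : Set (ProbabilityMeasure (Cov d × ℝ))} {D : Measure (Record d)} (hD : Realizable P Q D)
    {B : ℝ}
    (hQ : ∀ q ∈ Q, ∀ᵐ w ∂(q : Measure (Cov d × ℝ)), w.2 ∈ Set.Icc (-B) B) (t : Bool) :
    ∀ᵐ u ∂D, potentialOutcome t u ∈ Set.Icc (-B) B := by
  obtain ⟨q, hq, hqD⟩ := (hD t).2
  have h := hQ q hq
  rw [hqD] at h
  exact ae_of_ae_map (measurable_covOutcome t).aemeasurable h

/-- The law of the covariates of a realizable study has a density with respect to `ν`. -/
lemma Realizable.map_fst_absolutelyContinuous {P : Set (Cov d × ℝ → ℝ)}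
    {Q : Set (ProbabilityMeasure (Cov d × ℝ))} {D : Measure (Record d)} (hD : Realizable P Q D)
    {ν : Measure (Cov d)} (hQ : ∀ q ∈ Q, (q : Measure (Cov d × ℝ)).map Prod.fst ≪ ν) :
    (censoredLaw D).map Prod.fst ≪ ν := by
  obtain ⟨q, hq, hqD⟩ := (hD true).2
  have h := hQ q hq
  rw [hqD, Measure.map_map measurable_fst (measurable_covOutcome true)] at h
  rw [censoredLaw, Measure.map_map measurable_fst measurable_censor]
  exact h

/-- The members of `P` that are Borel, as functions of the covariates. -/
def borelSlices (P : Set (Cov d × ℝ → ℝ)) : Set (Cov d → ℝ) :=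
  {g | ∃ p ∈ P, Measurable p ∧ g = fun x => p (x, 0)}

lemma card_le_of_fatShatters_borelSlices {P : Set (Cov d × ℝ → ℝ)} {γ : ℝ}
    (hfat : fatDim P γ < ⊤) (S : Finset (Cov d)) (hS : FatShatters (borelSlices P) γ S) :
    S.card ≤ (fatDim P γ).toNat := by
  classical
  obtain ⟨r, hr⟩ := hS
  have hinj : Function.Injective fun x : Cov d => (x, (0 : ℝ)) := fun x y h => (Prod.ext_iff.1 h).1
  have hS' : FatShatters P γ (S.image fun x => (x, (0 : ℝ))) := by
    refine ⟨fun w => r w.1, fun b hb => ?_⟩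
    obtain ⟨g, ⟨p, hp, -, rfl⟩, hg⟩ := hr (fun x => b (x, 0)) fun s hs =>
      hb _ (Finset.mem_image_of_mem _ hs)
    refine ⟨p, hp, fun w hw => ?_⟩
    obtain ⟨x, hx, rfl⟩ := Finset.mem_image.1 hw
    exact hg x hx
  have h1 : ((S.image fun x => (x, (0 : ℝ))).card : ℕ∞) ≤ fatDim P γ :=
    le_iSup₂ (f := fun (S : Finset (Cov d × ℝ)) (_ : FatShatters P γ S) => (S.card : ℕ∞)) _ hS'
  rw [Finset.card_image_of_injective _ hinj] at h1
  have h2 := ENat.toNat_le_toNat h1 hfat.ne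
  simpa using h2

/-- The failure probability of the weighted estimator with a learned propensity score: once the
propensity score is `212γ`-accurate in `L¹`, the bias is below `(7/8)ε`, and Hoeffding's inequality
handles the remaining samples. -/
lemma measure_ipwEstimator_failure_le {D : Measure (Record d)} [IsProbabilityMeasure D]
    {p₀ p₁ : Cov d × ℝ → ℝ} {B c ε γ : ℝ} (h₀ : IsGenPropensity D false p₀)
    (h₁ : IsGenPropensity D true p₁) (hc₀ : p₀ ∈ overlapUnconf d c) (hc₁ : p₁ ∈ overlapUnconf d c)
    (hc : 0 < c) (hc2 : c < 1 / 2) (hB : 0 < B) (hε : 0 < ε) (hγ : γ = 1 / 256 * c ^ 2 * ε / B)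
    (hY : ∀ t, ∀ᵐ u ∂D, potentialOutcome t u ∈ Set.Icc (-B) B) {k l : ℕ} (hl : 0 < l)
    (hk : k ≤ k + l) {learn : (Fin k → Sample d) → Cov d → ℝ}
    (hlm : Measurable (Function.uncurry learn))
    (hlc : ∀ S x, c < learn S x ∧ learn S x < 1 - c) {δ₁ δ₂ : ℝ}
    (hδ₁ : (Measure.pi fun _ : Fin k => censoredLaw D).real
      {T | 212 * γ < ∫ s, |learn T s.1 - p₁ (s.1, 0)| ∂censoredLaw D} ≤ δ₁)
    (hδ₂ : 2 * Real.exp (-(512 * l * γ ^ 2)) ≤ δ₂) :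
    1 - (δ₁ + δ₂) ≤ (Measure.pi fun _ : Fin (k + l) => censoredLaw D).real
      {S | |ipwEstimator hk learn S - ate D| ≤ ε} := by
  have hD : IsProbabilityMeasure (censoredLaw D) :=
    Measure.isProbabilityMeasure_map measurable_censor.aemeasurable
  have hγB : 2 * (B / c) * (212 * γ) ≤ 7 / 8 * ε := by
    have : 2 * (B / c) * (212 * γ) = 424 / 256 * (c * ε) := by
      rw [hγ]; field_simp; norm_num
    rw [this]
    nlinarith
  have hterm : ∀ i, Measurable fun z : (Fin k → Sample d) × (Fin l → Sample d) =>
      ipwTerm (learn z.1) (z.2 i) := by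
    intro i
    have h1 : Measurable fun z : (Fin k → Sample d) × (Fin l → Sample d) =>
        learn z.1 (z.2 i).1 :=
      hlm.comp (measurable_fst.prodMk
        (measurable_fst.comp ((measurable_pi_apply i).comp measurable_snd)))
    have h2 : Measurable fun z : (Fin k → Sample d) × (Fin l → Sample d) =>
        (if (z.2 i).2.1 then (1 : ℝ) else 0) :=
      measurable_label.comp ((measurable_pi_apply i).comp measurable_snd)
    unfold ipwTerm
    fun_prop
  set A : Set ((Fin k → Sample d) × (Fin l → Sample d)) :=
    {z | ε < |(∑ i, ipwTerm (learn z.1) (z.2 i)) / l - ate D|} with hA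
  have hAm : MeasurableSet A := by
    refine measurableSet_lt measurable_const ?_
    fun_prop
  have hbound := prod_real_le_add (Measure.pi fun _ : Fin k => censoredLaw D)
    (Measure.pi fun _ : Fin l => censoredLaw D) hAm
    (le_trans (by positivity) hδ₂) hδ₁ (by
      intro T hT
      have hT' : ∫ s, |learn T s.1 - p₁ (s.1, 0)| ∂censoredLaw D ≤ 212 * γ := not_lt.1 hT
      have heT : Measurable (learn T) := hlm.comp (measurable_const.prodMk measurable_id)
      have hbias := abs_integral_ipwTerm_sub_ate_le h₀ h₁ hc₀ hc₁ hc hB.le hY heT (hlc T)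
      have hbias' : |∫ s, ipwTerm (learn T) s ∂censoredLaw D - ate D| ≤ 7 / 8 * ε :=
        hbias.trans ((mul_le_mul_of_nonneg_left hT' (by positivity)).trans hγB)
      have hconc := measure_abs_mean_sub_integral_ge_le (censoredLaw D) (measurable_ipwTerm heT)
        (ae_ipwTerm_mem_Icc hc hB.le hY heT (hlc T)) hl (t := ε / 8) (by positivity)
      refine le_trans (measureReal_mono ?_ (measure_ne_top _ _)) (hconc.trans (le_trans ?_ hδ₂))
      · intro S hS
        have hS' : ε < |(∑ i, ipwTerm (learn T) (S i)) / l - ate D| := hS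
        have := abs_sub_le ((∑ i, ipwTerm (learn T) (S i)) / l)
          (∫ s, ipwTerm (learn T) s ∂censoredLaw D) (ate D)
        simp only [Set.mem_ofPred_eq]
        linarith
      · -- the exponent for deviation `ε/8` of terms bounded by `B/c`
        have he : (l : ℝ) * (ε / 8) ^ 2 / (2 * (B / c) ^ 2)
            = 512 * l * γ ^ 2 / c ^ 2 := by
          rw [hγ]; field_simp; norm_num
        have hc21 : c ^ 2 ≤ 1 := by nlinarith
        have : 512 * l * γ ^ 2 ≤ (l : ℝ) * (ε / 8) ^ 2 / (2 * (B / c) ^ 2) := by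
          rw [he, le_div_iff₀ (by positivity)]
          exact mul_le_of_le_one_right (by positivity) hc21
        gcongr)
  have happ := (measurePreserving_append (censoredLaw D) k l).measure_preimage (s := toMeasurable
    (Measure.pi fun _ : Fin (k + l) => censoredLaw D)
    {S | |ipwEstimator hk learn S - ate D| ≤ ε}) (measurableSet_toMeasurable _ _).nullMeasurableSet
  rw [measure_toMeasurable] at happ
  rw [measureReal_def, ← happ, ← measureReal_def]
  have hsub : Aᶜ ⊆ (fun z : (Fin k → Sample d) × (Fin l → Sample d) => Fin.append z.1 z.2) ⁻¹'
      toMeasurable (Measure.pi fun _ : Fin (k + l) => censoredLaw D)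
        {S | |ipwEstimator hk learn S - ate D| ≤ ε} := by
    intro z hz
    refine subset_toMeasurable _ _ ?_
    have hz' : |(∑ i, ipwTerm (learn z.1) (z.2 i)) / l - ate D| ≤ ε := not_lt.1 hz
    simpa only [Set.mem_ofPred_eq, ipwEstimator_append] using hz'
  refine le_trans ?_ (measureReal_mono hsub (measure_ne_top _ _))
  rw [probReal_compl_eq_one_sub hAm]
  linarith

/-- With the generating function evaluated at `γ³/8`, the covering numbers on at most `2m` points
are bounded by `exp (60Dλ + mγ²)`: the number of points only enters through a term that the
concentration inequalities absorb. -/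
lemma coverBound_le {γ lam : ℝ} (hγ : 0 < γ) (hγ1 : γ ≤ 1) (hlam : Real.log 2 ≤ lam)
    (hlog : Real.log (1 / γ) ≤ 9 * lam) (D m : ℕ) {q : ℕ} (hq : q ≤ m + m) :
    coverBound D ⌈1 / γ⌉₊ q (γ ^ 3 / 8) ≤ Real.exp (60 * D * lam + m * γ ^ 2) := by
  have hx : 0 < γ ^ 3 / 8 := by positivity
  have hp : (⌈1 / γ⌉₊ : ℝ) ≤ 2 / γ := by
    have h1 := (Nat.ceil_lt_add_one (by positivity : 0 ≤ 1 / γ)).le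
    have h2 : 1 ≤ 1 / γ := by rw [le_div_iff₀ hγ]; linarith
    calc _ ≤ 1 / γ + 1 := h1
      _ ≤ 1 / γ + 1 / γ := by linarith
      _ = 2 / γ := by ring
  have h1 : ((γ ^ 3 / 8)⁻¹) ^ D ≤ Real.exp (30 * D * lam) := by
    have hlogx : Real.log ((γ ^ 3 / 8)⁻¹) ≤ 30 * lam := by
      have : (γ ^ 3 / 8)⁻¹ = (1 / γ) ^ 3 * 2 ^ 3 := by field_simp; norm_num
      rw [this, Real.log_mul (by positivity) (by positivity), Real.log_pow, Real.log_pow]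
      push_cast
      linarith
    have h2 : (γ ^ 3 / 8)⁻¹ ≤ Real.exp (30 * lam) :=
      (Real.log_le_iff_le_exp (inv_pos.2 hx)).1 hlogx
    calc _ ≤ Real.exp (30 * lam) ^ D := pow_le_pow_left₀ (inv_pos.2 hx).le h2 D
      _ = Real.exp (30 * D * lam) := by rw [← Real.exp_nat_mul]; congr 1; ring
  have h2 : (1 + (⌈1 / γ⌉₊ : ℝ) * (γ ^ 3 / 8)) ^ q ≤ Real.exp (m * γ ^ 2 / 2) := by
    have h3 : (⌈1 / γ⌉₊ : ℝ) * (γ ^ 3 / 8) ≤ γ ^ 2 / 4 := by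
      calc _ ≤ 2 / γ * (γ ^ 3 / 8) := mul_le_mul_of_nonneg_right hp hx.le
        _ = γ ^ 2 / 4 := by field_simp; norm_num
    have h4 : 1 + (⌈1 / γ⌉₊ : ℝ) * (γ ^ 3 / 8) ≤ Real.exp (γ ^ 2 / 4) := by
      linarith [Real.add_one_le_exp (γ ^ 2 / 4)]
    calc _ ≤ (1 + (⌈1 / γ⌉₊ : ℝ) * (γ ^ 3 / 8)) ^ (m + m) :=
          pow_le_pow_right₀ (by linarith [mul_nonneg (Nat.cast_nonneg (α := ℝ) ⌈1 / γ⌉₊) hx.le]) hq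
      _ ≤ Real.exp (γ ^ 2 / 4) ^ (m + m) := pow_le_pow_left₀ (by positivity) h4 _
      _ = Real.exp (m * γ ^ 2 / 2) := by rw [← Real.exp_nat_mul]; congr 1; push_cast; ring
  calc coverBound D ⌈1 / γ⌉₊ q (γ ^ 3 / 8)
      ≤ (Real.exp (30 * D * lam) * Real.exp (m * γ ^ 2 / 2)) ^ 2 := by
        unfold coverBound
        gcongr
    _ = Real.exp (60 * D * lam + m * γ ^ 2) := by
        rw [← Real.exp_add, ← Real.exp_nat_mul]
        congr 1
        push_cast
        ring

/-- Conversion of a bound on the exponent into a failure probability. -/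
lemma two_mul_exp_le {δ y : ℝ} (hδ : 0 < δ) (hδ1 : δ < 1) (hy : y ≤ -(3 * Real.log (2 / δ))) :
    2 * Real.exp y ≤ δ / 4 := by
  have h1 : Real.exp y ≤ Real.exp (-(3 * Real.log (2 / δ))) := Real.exp_le_exp.2 hy
  have h2 : Real.exp (-(3 * Real.log (2 / δ))) = (δ / 2) ^ 3 := by
    rw [← Real.exp_log (show (0 : ℝ) < (δ / 2) ^ 3 by positivity), Real.log_pow,
      Real.log_div hδ.ne' two_ne_zero, Real.log_div two_ne_zero hδ.ne']
    congr 1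
    push_cast
    ring
  rw [h2] at h1
  have h3 : δ ^ 2 ≤ 1 := by nlinarith
  nlinarith

end Estimator

end CausalATE

open CausalATE

theorem theorem5p1 :
    ∃ η : ℝ, 1 / 256 ≤ η ∧ ∃ C : ℝ, 0 < C ∧
      ∀ (d : ℕ) (c B ε δ : ℝ), 0 < c → c < 1 / 2 → 0 < B → 0 < ε → ε < 1 → 0 < δ → δ < 1 →
      ∀ (P : Set (CausalATE.Cov d × ℝ → ℝ))
        (Q : Set (ProbabilityMeasure (CausalATE.Cov d × ℝ)))
        (ν : Measure (CausalATE.Cov d)), SigmaFinite ν →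
      -- standing convention: the covariates have a density with respect to `ν`
      (∀ q ∈ Q, (q : Measure (CausalATE.Cov d × ℝ)).map Prod.fst ≪ ν) →
      P ⊆ CausalATE.overlapUnconf d c →
      CausalATE.fatDim P (η * c ^ 2 * ε / B) < ⊤ →
      (∀ q ∈ Q, ∀ᵐ w ∂(q : Measure (CausalATE.Cov d × ℝ)), w.2 ∈ Set.Icc (-B) B) →
      ∀ n : ℕ,
        C * (B ^ 2 / (c ^ 4 * ε ^ 2) *
          (((CausalATE.fatDim P (η * c ^ 2 * ε / B)).toNat : ℝ) * Real.log (B / (c ^ 2 * ε))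
            + Real.log (2 / δ))) ≤ (n : ℝ) →
        ∃ (k : ℕ) (hk : k ≤ n)
          (learn : (Fin k → CausalATE.Sample d) → CausalATE.Cov d → ℝ),
          Measurable (Function.uncurry learn) ∧
          (∀ S x, c < learn S x ∧ learn S x < 1 - c) ∧
          ∀ D : Measure (CausalATE.Record d), IsProbabilityMeasure D →
            CausalATE.Realizable P Q D →
            1 - δ ≤ (Measure.pi fun _ : Fin n => CausalATE.censoredLaw D).real
              {S | |CausalATE.ipwEstimator hk learn S - CausalATE.ate D| ≤ ε} := by
  -- `10485760 = 160 * 256²`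
  refine ⟨1 / 256, le_rfl, 10485760, by norm_num, ?_⟩
  intro d c B ε δ hc hc2 hB hε hε1 hδ hδ1 P Q ν hν hQν hP hfat hQB n hn
  have hconst : ∀ (k : ℕ), Measurable (Function.uncurry
      fun (_ : Fin k → Sample d) (_ : Cov d) => (1 / 2 : ℝ)) := fun k => measurable_const
  rcases (borelSlices P).eq_empty_or_nonempty with hne | hne
  · -- no Borel propensity score: no study is realizable
    refine ⟨0, Nat.zero_le n, fun _ _ => 1 / 2, hconst 0, fun _ _ => ⟨hc2, by linarith⟩, ?_⟩
    intro D _ hreal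
    obtain ⟨p, hp, hpD⟩ := (hreal true).1
    exact absurd (show (fun x => p (x, 0)) ∈ borelSlices P from ⟨p, hp, hpD.1, rfl⟩) (by simp [hne])
  rcases le_or_gt (2 * B) ε with hBε | hBε
  · -- the effect is so small that the empty average `0` is accurate
    refine ⟨n, le_rfl, fun _ _ => 1 / 2, hconst n, fun _ _ => ⟨hc2, by linarith⟩, ?_⟩
    intro D hDp hreal
    have hate := abs_ate_le (hreal.ae_potentialOutcome hQB)
    have hD : IsProbabilityMeasure (censoredLaw D) :=
      Measure.isProbabilityMeasure_map measurable_censor.aemeasurable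
    have huniv : {S : Fin n → Sample d | |ipwEstimator le_rfl
        (fun (_ : Fin n → Sample d) (_ : Cov d) => (1 / 2 : ℝ)) S - ate D| ≤ ε} = Set.univ := by
      refine Set.eq_univ_of_forall fun S => ?_
      simp only [Set.mem_ofPred_eq, ipwEstimator, sub_self, div_zero, zero_mul, zero_sub, abs_neg]
      linarith
    rw [huniv, probReal_univ]
    linarith
  -- the main case
  set γ : ℝ := 1 / 256 * c ^ 2 * ε / B with hγdef
  set Df : ℕ := (fatDim P γ).toNat with hDf
  set lam := Real.log (B / (c ^ 2 * ε)) with hlamdef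
  set L := Real.log (2 / δ) with hLdef
  have hγ : 0 < γ := by positivity
  have hratio : B / (c ^ 2 * ε) = 1 / (256 * γ) := by rw [hγdef]; field_simp
  have hγ1 : 512 * γ ≤ 1 := by
    have h1 : c ^ 2 ≤ 1 / 4 := by nlinarith
    rw [hγdef, mul_div_assoc', div_le_one hB]
    nlinarith
  have hlog2 : (1 : ℝ) / 2 ≤ Real.log 2 := by linarith [Real.log_two_gt_d9]
  have hlam : Real.log 2 ≤ lam := by
    rw [hlamdef, hratio]
    refine Real.log_le_log (by norm_num) ?_
    rw [le_div_iff₀ (by positivity)]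
    linarith
  have hloginv : Real.log (1 / γ) ≤ 9 * lam := by
    have h1 : 1 / γ = B / (c ^ 2 * ε) * 2 ^ 8 := by rw [hratio]; field_simp; norm_num
    rw [h1, Real.log_mul (by positivity) (by positivity), Real.log_pow]
    push_cast
    linarith
  have hL : Real.log 2 ≤ L := by
    refine Real.log_le_log (by norm_num) ?_
    rw [le_div_iff₀ hδ]
    linarith
  have hDlam : 0 ≤ (Df : ℝ) * lam := mul_nonneg (Nat.cast_nonneg _) (by linarith)
  have hn' : 160 * (Df * lam + L) ≤ n * γ ^ 2 := by
    have h1 : B ^ 2 / (c ^ 4 * ε ^ 2) = 1 / (65536 * γ ^ 2) := by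
      rw [hγdef]; field_simp; norm_num
    rw [h1] at hn
    have h2 := mul_le_mul_of_nonneg_right hn (sq_nonneg γ)
    have h3 : 10485760 * (1 / (65536 * γ ^ 2) * (Df * lam + L)) * γ ^ 2
        = 160 * (Df * lam + L) := by
      field_simp; ring
    linarith
  obtain ⟨m, l, hnm, hml, hmn⟩ : ∃ m l : ℕ, n = m + m + l ∧ m ≤ l ∧ (n : ℝ) ≤ 8 * m := by
    have hn4 : 4 ≤ n := by
      have h1 : (n : ℝ) * γ ^ 2 ≤ n * 1 := by
        refine mul_le_mul_of_nonneg_left ?_ (Nat.cast_nonneg _)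
        nlinarith
      have : (4 : ℝ) ≤ n := by linarith
      exact_mod_cast this
    refine ⟨n / 4, n - (n / 4 + n / 4), by omega, by omega, ?_⟩
    have : n ≤ 8 * (n / 4) := by omega
    exact_mod_cast this
  have hm : 0 < m := by
    rcases Nat.eq_zero_or_pos m with rfl | h
    · have : (n : ℝ) * γ ^ 2 ≤ 0 := by
        rw [Nat.cast_zero, mul_zero] at hmn
        exact mul_nonpos_of_nonpos_of_nonneg hmn (sq_nonneg γ)
      linarith
    · exact h
  have hE : 20 * (Df * lam + L) ≤ m * γ ^ 2 := by
    have := mul_le_mul_of_nonneg_right hmn (sq_nonneg γ)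
    linarith
  have hlE : m * γ ^ 2 ≤ l * γ ^ 2 :=
    mul_le_mul_of_nonneg_right (Nat.cast_le.2 hml) (sq_nonneg γ)
  subst hnm
  -- the countable dense subfamily and the learning rule
  have hFm : ∀ f ∈ borelSlices P, Measurable f := by
    rintro f ⟨p, -, hp, rfl⟩
    exact measurable_slice hp
  have hFc : ∀ f ∈ borelSlices P, ∀ x, c < f x ∧ f x < 1 - c := by
    rintro f ⟨p, hp, -, rfl⟩ x
    exact ((hP hp).2 x 0 0).2
  have hF01 : ∀ f ∈ borelSlices P, ∀ x, f x ∈ Set.Icc (0 : ℝ) 1 := by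
    rintro f ⟨p, hp, -, rfl⟩ x
    exact (hP hp).1 _
  obtain ⟨f, hfF, hfd⟩ := exists_seq_dense ν hne hFm hF01
  have hhalf : 2 * Real.exp (-(32 * m * γ ^ 2)) ≤ 1 / 2 := by
    have h1 : -(32 * m * γ ^ 2) ≤ -(3 * Real.log (2 / δ)) := by linarith
    linarith [two_mul_exp_le hδ hδ1 h1]
  have hxle : γ ^ 3 / 8 ≤ 1 := by
    have : γ ^ 3 ≤ 1 := pow_le_one₀ hγ.le (by linarith)
    linarith
  obtain ⟨idx, hidx, hlearn⟩ := exists_learner (Ω := Sample d) measurable_fst measurable_label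
    label_mem_Icc hF01 hγ (card_le_of_fatShatters_borelSlices hfat) hfF (fun i => hFm _ (hfF i))
    (x := γ ^ 3 / 8) (by positivity) hxle (Nat.le_ceil (1 / γ)) hm hhalf
  have hlm : Measurable (Function.uncurry
      fun (T : Fin (m + m) → Sample d) (x : Cov d) => f (idx T) x) := by
    have h1 : Measurable fun z : ℕ × Cov d => f z.1 z.2 :=
      measurable_from_prod_countable_right fun i => hFm _ (hfF i)
    exact h1.comp ((hidx.comp measurable_fst).prodMk measurable_snd)
  refine ⟨m + m, Nat.le_add_right _ _, fun T x => f (idx T) x, hlm,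
    fun T x => hFc _ (hfF _) x, ?_⟩
  intro D hDp hreal
  obtain ⟨p₀, hp₀, hpD₀⟩ := (hreal false).1
  obtain ⟨p₁, hp₁, hpD₁⟩ := (hreal true).1
  have hDc : IsProbabilityMeasure (censoredLaw D) :=
    Measure.isProbabilityMeasure_map measurable_censor.aemeasurable
  have happrox : ∃ i, ∫ s, |f i s.1 - p₁ (s.1, 0)| ∂censoredLaw D ≤ 4 * γ := by
    have hprob : IsProbabilityMeasure ((censoredLaw D).map Prod.fst) :=
      Measure.isProbabilityMeasure_map measurable_fst.aemeasurable
    obtain ⟨i, hi⟩ := hfd (fun x => p₁ (x, 0)) ⟨p₁, hp₁, hpD₁.1, rfl⟩ _ hprob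
      (hreal.map_fst_absolutelyContinuous hQν) (4 * γ) (by positivity)
    have hmi : Measurable fun x => |f i x - p₁ (x, 0)| :=
      ((hFm _ (hfF i)).sub (measurable_slice hpD₁.1)).abs
    rw [integral_map measurable_fst.aemeasurable hmi.aestronglyMeasurable] at hi
    exact ⟨i, hi⟩
  have hfail := hlearn (censoredLaw D) hDc _ (isRegression_propensity hpD₁ (hP hp₁)) happrox
  have hγle : γ ≤ 1 := by linarith
  have hN2 := coverBound_le hγ hγle hlam hloginv Df m (le_refl (m + m))
  have hN1 := coverBound_le hγ hγle hlam hloginv Df m (Nat.le_add_right m m)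
  -- the two stages of learning fail with probability at most `δ/4` each
  have hfail1 : 2 * (coverBound Df ⌈1 / γ⌉₊ (m + m) (γ ^ 3 / 8)
      * Real.exp (-(32 * m * γ ^ 2))) ≤ δ / 4 := by
    refine le_trans ?_ (two_mul_exp_le hδ hδ1
      (y := 60 * Df * lam + m * γ ^ 2 + -(32 * m * γ ^ 2)) (by linarith))
    rw [Real.exp_add]
    gcongr
  have hfail2 : coverBound Df ⌈1 / γ⌉₊ m (γ ^ 3 / 8) ^ 2
      * (2 * Real.exp (-(8 * m * γ ^ 2))) ≤ δ / 4 := by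
    refine le_trans ?_ (two_mul_exp_le hδ hδ1
      (y := 2 * (60 * Df * lam + m * γ ^ 2) + -(8 * m * γ ^ 2)) (by linarith))
    have h0 : 0 ≤ coverBound Df ⌈1 / γ⌉₊ m (γ ^ 3 / 8) := by unfold coverBound; positivity
    have h1 := pow_le_pow_left₀ h0 hN1 2
    rw [← Real.exp_nat_mul, Nat.cast_ofNat] at h1
    rw [Real.exp_add]
    have := mul_le_mul_of_nonneg_right h1 (Real.exp_pos (-(8 * m * γ ^ 2))).le
    linarith
  have hfail3 : 2 * Real.exp (-(512 * l * γ ^ 2)) ≤ δ / 4 :=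
    two_mul_exp_le hδ hδ1 (by linarith)
  have hfinal := measure_ipwEstimator_failure_le hpD₀ hpD₁ (hP hp₀) (hP hp₁) hc hc2 hB hε hγdef
    (hreal.ae_potentialOutcome hQB) (hm.trans_le hml) (Nat.le_add_right (m + m) l) hlm
    (fun T x => hFc _ (hfF _) x) hfail hfail3
  refine le_trans ?_ hfinal
  linarith
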